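/- Let $X$ be a complex Banach space and $\mathbb R_+=[0,\infty)$; functions on $\mathbb R_+$ are extended by $0$ to $\mathbb R$. For $\mathbb J\in\{\mathbb R_+,\mathbb R\}$ write $\varphi\in L^1_{loc}(\mathbb J,X)\cap\mathcal S'(\mathbb R,X)$ if $\varphi$ is locally (Bochner) integrable, $f\varphi$ is integrable for every $f\in\mathcal S(\mathbb R)$, and $f\mapsto\int f\varphi$ is an $X$-valued tempered distribution. For such $\varphi$ put $\mathcal L\varphi(\lambda)=\int_0^\infty e^{-\lambda t}\varphi(t)\,dt$ for $\operatorname{Re}\lambda>0$ and, for $f\in\mathcal S(\mathbb R)$, $\varphi*f(t)=\int_{\mathbb R}\varphi(t-s)f(s)\,ds$ and $\hat f(\omega)=\int_{\mathbb R} e^{-i\omega t}f(t)\,dt$. Let $\gamma_\omega(t)=e^{i\omega t}$ and $P\psi(t)=\int_0^t\psi(s)\,ds$. * The Laplace spectrum $sp^{\mathcal L}(\varphi)$ is the set of $\omega\in\mathbb R$ for which $\mathcal L\varphi$ has no holomorphic extension to a neighbourhood of $i\omega$. If $\omega\notin sp^{\mathcal L}(\varphi)$, $\overline{\mathcal L}\varphi(i\omega)$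 is the value at $i\omega$ of such an extension. * The weak Laplace spectrum $sp^{w\mathcal L}(\varphi)$ is the set of $\omega\in\mathbb R$ for which there are no $\varepsilon>0$ and $h\in L^1((\omega-\varepsilon,\omega+\varepsilon),X)$ such that $\lim_{a\searrow0}\int_{\mathbb R}\mathcal L\varphi(a+is)u(s)\,ds=\int_{\omega-\varepsilon}^{\omega+\varepsilon}h(s)u(s)\,ds$ for all $u\in C_c^\infty(\mathbb R)$ with $\operatorname{supp}u\subset(\omega-\varepsilon,\omega+\varepsilon)$. * $C_0(\mathbb R_+,X)$ is the space of continuous functions vanishing at infinity and $BUC(\mathbb R_+,X)$ that of bounded uniformly continuous functions. The reduced Beurling spectrum $sp_{C_0(\mathbb R_+,X)}(\varphi)$ is the set of $\omega\in\mathbb R$ for which there is no $f\in\mathcal S(\mathbb R)$ with $\hat f(\omega)\ne0$ and $\varphi*f|_{\mathbb R_+}\in C_0(\mathbb R_+,X)$. * $\mathcal E_0(\mathbb R_+,X)$ is the set of $\psi\in L^\infty(\mathbb R_+,X)$ that are ergodic with mean $0$: $\sup_{t\ge0}\bigl\|\frac1T\int_0^T\psi(t+s)\,ds\bigr\|\to0$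 as $T\to\infty$. **Theorem 2.4.** Let $\varphi\in L^1_{loc}(\mathbb R_+,X)\cap\mathcal S'(\mathbb R,X)$. (i) For every $f\in\mathcal S(\mathbb R)$, $\varphi*f\in L^1_{loc}(\mathbb R,X)\cap\mathcal S'(\mathbb R,X)$ and $sp^{w\mathcal L}(\varphi*f)\subset sp^{w\mathcal L}(\varphi)\cap\operatorname{supp}\hat f$. (ii) $sp_{C_0(\mathbb R_+,X)}(\varphi)\subset sp^{w\mathcal L}(\varphi)$. (iii) If $\varphi\in L^\infty(\mathbb R_+,X)$ and $\omega_0\notin sp^{w\mathcal L}(\varphi)$, then $\gamma_{-\omega_0}\varphi\in\mathcal E_0(\mathbb R_+,X)$. (iv) If $\varphi\in L^\infty(\mathbb R_+,X)$ and $\omega_0\notin sp^{\mathcal L}(\varphi)$, then $P(\gamma_{-\omega_0}\varphi)-\overline{\mathcal L}\varphi(i\omega_0)\in BUC(\mathbb R_+,X)\cap\mathcal E_0(\mathbb R_+,X)$. -/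

import Mathlib

open MeasureTheory Set Filter Topology
open scoped SchwartzMap

noncomputable section

namespace HalfLine

variable {X : Type*} [NormedAddCommGroup X] [NormedSpace ℂ X]

/-- `φ ∈ L¹_loc(ℝ, X) ∩ 𝓢'(ℝ, X)`: the function `φ` is locally integrable, `f φ` is integrable for
every Schwartz function `f`, and `f ↦ ∫ f φ` is an `X`-valued tempered distribution. -/
structure IsTemperedFun (φ : ℝ → X) : Prop where
  locallyIntegrable : LocallyIntegrable φ volume
  integrable_smul : ∀ f : 𝓢(ℝ, ℂ), Integrable (fun t => f t • φ t) volume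
  exists_distribution : ∃ S : 𝓢'(ℝ, X), ∀ f : 𝓢(ℝ, ℂ), S f = ∫ t, f t • φ t

/-- `φ ∈ L¹_loc(ℝ₊, X) ∩ 𝓢'(ℝ, X)`, with `ℝ₊ = [0, ∞)`: a function on `ℝ₊` is identified with its
extension by `0` to `ℝ`. -/
def IsTemperedHalfLineFun (φ : ℝ → X) : Prop :=
  IsTemperedFun φ ∧ ∀ t < 0, φ t = 0

/-- The Laplace transform `∫₀^∞ e^{-lam t} φ(t) dt` (used for `Re lam > 0`). -/
def laplace (φ : ℝ → X) (lam : ℂ) : X :=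
  ∫ t in Ioi (0 : ℝ), Complex.exp (-lam * t) • φ t

/-- The convolution `(φ ∗ f)(t) = ∫ φ(t - s) f(s) ds` over `ℝ`. -/
def conv (φ : ℝ → X) (f : ℝ → ℂ) : ℝ → X :=
  MeasureTheory.convolution f φ (ContinuousLinearMap.lsmul ℂ ℂ) volume

/-- The Fourier transform `∫ e^{-i ω t} f(t) dt`. -/
def fourierHat (f : ℝ → ℂ) (ω : ℝ) : ℂ :=
  ∫ t : ℝ, Complex.exp (-(Complex.I * ω * t)) * f t

/-- `γ_ω φ`, that is `t ↦ e^{i ω t} φ(t)`. -/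
def modulate (ω : ℝ) (φ : ℝ → X) (t : ℝ) : X :=
  Complex.exp (Complex.I * ω * t) • φ t

/-- The indefinite integral `(Pφ)(t) = ∫₀ᵗ φ(s) ds`. -/
def primitive (φ : ℝ → X) (t : ℝ) : X := ∫ s in (0 : ℝ)..t, φ s

/-- `G` is holomorphic in a neighbourhood `V` of `z` and extends there the function `F`, given on
the open right half-plane. -/
def IsHolomorphicExtensionAt (F : ℂ → X) (z : ℂ) (G : ℂ → X) : Prop :=
  ∃ V : Set ℂ, IsOpen V ∧ z ∈ V ∧ DifferentiableOn ℂ G V ∧ EqOn G F (V ∩ {w | 0 < w.re})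

/-- The Laplace spectrum: all `ω` such that `iω` is a singular point of the Laplace transform. -/
def laplaceSpectrum (φ : ℝ → X) : Set ℝ :=
  {ω | ¬ ∃ G : ℂ → X, IsHolomorphicExtensionAt (laplace φ) (Complex.I * ω) G}

/-- `iω` is a weak regular point of `F`, given on the open right half-plane. -/
def IsWeakRegularPoint (F : ℂ → X) (ω : ℝ) : Prop :=
  ∃ ε > 0, ∃ h : ℝ → X, IntegrableOn h (Ioo (ω - ε) (ω + ε)) volume ∧
    ∀ u : ℝ → ℂ, ContDiff ℝ ((⊤ : ℕ∞) : WithTop ℕ∞) u → HasCompactSupport u → tsupport u ⊆ Ioo (ω - ε) (ω + ε) →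
      Tendsto (fun a : ℝ => ∫ s : ℝ, u s • F (a + Complex.I * s)) (𝓝[>] 0)
        (𝓝 (∫ s in Ioo (ω - ε) (ω + ε), u s • h s))

/-- The weak Laplace spectrum. -/
def weakLaplaceSpectrum (φ : ℝ → X) : Set ℝ :=
  {ω | ¬ IsWeakRegularPoint (laplace φ) ω}

/-- The functions whose restriction to `ℝ₊` belongs to `C₀(ℝ₊, X)`. -/
def C0 (X : Type*) [NormedAddCommGroup X] : Set (ℝ → X) :=
  {ψ | ContinuousOn ψ (Ici 0) ∧ Tendsto ψ atTop (𝓝 0)}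

/-- The functions whose restriction to `ℝ₊` belongs to `BUC(ℝ₊, X)`, that is, is bounded and
uniformly continuous. -/
def BUC (X : Type*) [NormedAddCommGroup X] : Set (ℝ → X) :=
  {ψ | (∃ C : ℝ, ∀ t ∈ Ici (0 : ℝ), ‖ψ t‖ ≤ C) ∧ UniformContinuousOn ψ (Ici 0)}

/-- `ψ ∈ L^∞(ℝ₊, X)`. -/
def MemLInfty (ψ : ℝ → X) : Prop := MemLp ψ ⊤ (volume.restrict (Ici (0 : ℝ)))

/-- `ψ` is ergodic on `ℝ₊` with mean `m`: the averages `(1/T) ∫₀ᵀ ψ(t + s) ds` tend to `m` as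
`T → ∞`, uniformly in `t ∈ ℝ₊`. -/
def IsErgodicWithMean (ψ : ℝ → X) (m : X) : Prop :=
  TendstoUniformlyOn (fun (T : ℝ) (t : ℝ) => (1 / T : ℝ) • ∫ s in (0 : ℝ)..T, ψ (t + s))
    (fun _ => m) atTop (Ici (0 : ℝ))

/-- `𝓔₀(ℝ₊, X)`: the essentially bounded ergodic functions with mean `0`. -/
def E0 (X : Type*) [NormedAddCommGroup X] [NormedSpace ℂ X] : Set (ℝ → X) :=
  {ψ | MemLInfty ψ ∧ IsErgodicWithMean ψ 0}

/-- The reduced Beurling spectrum of `φ` relative to a class `A` of functions on `ℝ₊`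
(`A` is given as the set of all functions on `ℝ` whose restriction to `ℝ₊` is in the class):
`ω` is regular if there is a Schwartz function `f` with nonzero Fourier transform at `ω` such
that `φ ∗ f`, restricted to `ℝ₊`, is in the class. -/
def reducedBeurlingSpectrum (A : Set (ℝ → X)) (φ : ℝ → X) : Set ℝ :=
  {ω | ¬ ∃ f : 𝓢(ℝ, ℂ), fourierHat f ω ≠ 0 ∧ conv φ f ∈ A}

end HalfLine

end

noncomputable section

namespace HalfLine

variable {X : Type*} [NormedAddCommGroup X] [NormedSpace ℂ X]

/-! A function of the half-line class is integrable against `(1 + |t|)⁻ᵏ` for some `k`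
(`exists_isWeighted`), so the integrals below converge absolutely and Fubini applies. As `a ↘ 0`,
the Laplace transform on the line `Re = a` tends, as a distribution, to the Fourier transform of `φ`
(`IsWeighted.tendsto_integral_smul_laplace`). Hence a point is weakly regular exactly when that
Fourier transform is an integrable function `h` near it.

Convolution with `f` multiplies the Fourier transform by `f̂`, which gives (i); the part of `φ ∗ f`
on the negative axis is integrable and only contributes a continuous function. For (ii), let `f̂` be
a bump at `ω`: then `φ ∗ f` is the inverse Fourier transform of the integrable function `f̂ h`, and
Riemann–Lebesgue applies (`IsWeighted.exists_conv_mem_C0`).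

Parts (iii) and (iv) are Tauberian, with `ω₀` moved to `0` by modulation. If `∫ f = 1`, the
integrals of a bounded `ψ` and of `ψ ∗ f` over any interval differ by a bounded amount, so the
averages of `ψ` vanish like those of a `C₀` function. For (iv), with `c` the value of the extension
at `0`, the Laplace transform of `Pψ - c` is `(ℒψ(z) - c) / z`, whose singularity at `0` is
removable. So the argument for (iii) applies once `Pψ - c` is bounded, and this follows from its
controlled increments by comparison with its convolution by `f`. -/

/-- `φ` is measurable and integrable with respect to the weight `(1 + |t|)⁻ᵏ`. -/
structure IsWeighted (k : ℕ) (φ : ℝ → X) : Prop where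
  aestronglyMeasurable : AEStronglyMeasurable φ volume
  integrable_weight : Integrable (fun t : ℝ => ((1 + |t|) ^ k)⁻¹ * ‖φ t‖) volume

/-! ### Polynomial weights from integrability against Schwartz functions -/

/-- Since `k ≤ n k`, the terms with `k ≥ j + 2` are at most `(k + 1)⁻²`. This makes the coefficients
used below rapidly decreasing. -/
lemma summable_pow_div_pow {n : ℕ → ℕ} (hn : StrictMono n) (j : ℕ) :
    Summable fun k => (1 + (n k : ℝ)) ^ j * ((1 + (n k : ℝ)) ^ k)⁻¹ := by
  have h2 : Summable fun k : ℕ => (((k + 1 : ℕ) : ℝ) ^ 2)⁻¹ :=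
    (summable_nat_add_iff 1).2 (Real.summable_nat_pow_inv.2 one_lt_two)
  refine h2.of_norm_bounded_eventually_nat ?_
  filter_upwards [eventually_ge_atTop (j + 2)] with k hk
  have hk' : (k : ℝ) ≤ n k := by exact_mod_cast hn.id_le k
  have h1 : (0 : ℝ) < 1 + n k := by positivity
  have h3 : (1 : ℝ) ≤ 1 + n k := by linarith [(Nat.cast_nonneg (n k) : (0 : ℝ) ≤ n k)]
  rw [Real.norm_of_nonneg (by positivity), ← div_eq_mul_inv, div_le_iff₀ (by positivity),
    inv_mul_eq_div, le_div_iff₀ (by positivity)]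
  calc (1 + (n k : ℝ)) ^ j * ((k + 1 : ℕ) : ℝ) ^ 2 ≤ (1 + (n k : ℝ)) ^ j * (1 + n k) ^ 2 := by
        gcongr; push_cast; linarith
    _ = (1 + (n k : ℝ)) ^ (j + 2) := (pow_add _ _ _).symm
    _ ≤ _ := pow_le_pow_right₀ h3 hk

/-- Sums of translated bump functions with rapidly decreasing coefficients are Schwartz functions. -/
lemma exists_schwartz_ge {n : ℕ → ℕ} (hn : StrictMono n) :
    ∃ f : 𝓢(ℝ, ℂ), ∀ k, ∀ x ∈ Icc (n k : ℝ) (n k + 1),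
      ((1 + (n k : ℝ)) ^ k)⁻¹ ≤ ‖f x‖ := by
  -- With inner radius `1`, the bump moved to `n k` equals `1` on all of `[n k, n k + 1]`.
  let b₀ : ContDiffBump (0 : ℝ) := ⟨1, 2, one_pos, one_lt_two⟩
  let b : 𝓢(ℝ, ℝ) := b₀.hasCompactSupport.toSchwartzMap b₀.contDiff
  have hb : ∀ x, b x = b₀ x := fun x => rfl
  let T : ℕ → ℝ → ℝ := fun k x => ((1 + (n k : ℝ)) ^ k)⁻¹ • b (x - n k)
  have hTs : ∀ k, ContDiff ℝ ((⊤ : ℕ∞) : WithTop ℕ∞) (T k) := fun k =>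
    ContDiff.const_smul (f := fun x => b (x - n k)) ((1 + (n k : ℝ)) ^ k)⁻¹
      ((b.smooth ⊤).comp (contDiff_id.sub contDiff_const))
  have hTd : ∀ k m x, iteratedFDeriv ℝ m (T k) x =
      ((1 + (n k : ℝ)) ^ k)⁻¹ • iteratedFDeriv ℝ m b (x - n k) := by
    intro k m x
    have h := iteratedFDeriv_const_smul_apply (𝕜 := ℝ) (i := m) (a := ((1 + (n k : ℝ)) ^ k)⁻¹)
      (f := fun x => b (x - n k)) (x := x)
      ((((b.smooth ⊤).comp (contDiff_id.sub contDiff_const)).of_le (by exact_mod_cast le_top)).contDiffAt)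
    rw [iteratedFDeriv_comp_sub] at h
    exact h
  have hbd : ∀ j m : ℕ, ∃ C : ℝ, ∀ k x, ‖x‖ ^ j * ‖iteratedFDeriv ℝ m (T k) x‖ ≤
      C * ((1 + (n k : ℝ)) ^ j * ((1 + (n k : ℝ)) ^ k)⁻¹) := by
    intro j m
    refine ⟨2 ^ j * ((Finset.Iic (j, m)).sup fun m => SchwartzMap.seminorm ℝ m.1 m.2) b,
      fun k x => ?_⟩
    rw [hTd, norm_smul, Real.norm_of_nonneg (by positivity : (0 : ℝ) ≤ ((1 + (n k : ℝ)) ^ k)⁻¹)]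
    -- The polynomial weight is moved from `x` to `x - n k`, at the cost of a power of `1 + n k`
    -- that the coefficient absorbs.
    have h1 : ‖x‖ ^ j ≤ (1 + (n k : ℝ)) ^ j * (1 + ‖x - n k‖) ^ j := by
      rw [← mul_pow]
      gcongr
      have : ‖x‖ ≤ ‖x - n k‖ + n k := by
        simpa using norm_add_le (x - (n k : ℝ)) (n k : ℝ)
      nlinarith [norm_nonneg (x - (n k : ℝ)), (Nat.cast_nonneg (n k) : (0 : ℝ) ≤ n k)]
    have h2 := SchwartzMap.one_add_le_sup_seminorm_apply (𝕜 := ℝ) (m := (j, m)) le_rfl le_rfl b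
      (x - n k)
    calc _ ≤ ((1 + (n k : ℝ)) ^ j * (1 + ‖x - n k‖) ^ j) *
          (((1 + (n k : ℝ)) ^ k)⁻¹ * ‖iteratedFDeriv ℝ m b (x - n k)‖) := by gcongr
      _ = ((1 + ‖x - n k‖) ^ j * ‖iteratedFDeriv ℝ m b (x - n k)‖) *
          ((1 + (n k : ℝ)) ^ j * ((1 + (n k : ℝ)) ^ k)⁻¹) := by ring
      _ ≤ _ := mul_le_mul_of_nonneg_right h2 (by positivity)
  choose C hC using hbd
  have hC0 : ∀ m k x, ‖iteratedFDeriv ℝ m (T k) x‖ ≤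
      C 0 m * ((1 + (n k : ℝ)) ^ 0 * ((1 + (n k : ℝ)) ^ k)⁻¹) := by
    intro m k x
    simpa using hC 0 m k x
  have hsum : ∀ j m, Summable fun k => C j m * ((1 + (n k : ℝ)) ^ j * ((1 + (n k : ℝ)) ^ k)⁻¹) :=
    fun j m => (summable_pow_div_pow hn j).mul_left _
  let f : 𝓢(ℝ, ℝ) :=
    { toFun := fun x => ∑' k, T k x
      smooth' := contDiff_tsum hTs (fun m _ => hsum 0 m) (fun m k x _ => hC0 m k x)
      decay' := by
        intro j m
        refine ⟨∑' k, C j m * ((1 + (n k : ℝ)) ^ j * ((1 + (n k : ℝ)) ^ k)⁻¹), fun x => ?_⟩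
        rw [iteratedFDeriv_tsum_apply (N := ⊤) hTs (fun m _ => hsum 0 m)
          (fun m k x _ => hC0 m k x) (by exact_mod_cast le_top)]
        have hs1 : Summable fun k => ‖iteratedFDeriv ℝ m (T k) x‖ :=
          (hsum 0 m).of_nonneg_of_le (fun _ => norm_nonneg _) (fun k => hC0 m k x)
        calc _ ≤ ‖x‖ ^ j * ∑' k, ‖iteratedFDeriv ℝ m (T k) x‖ := by
              gcongr; exact norm_tsum_le_tsum_norm hs1
          _ = ∑' k, ‖x‖ ^ j * ‖iteratedFDeriv ℝ m (T k) x‖ := tsum_mul_left.symm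
          _ ≤ _ := (hs1.mul_left _).tsum_le_tsum (fun k => hC j m k x) (hsum j m) }
  refine ⟨f.postcompCLM Complex.ofRealCLM, fun k x hx => ?_⟩
  rw [SchwartzMap.postcompCLM_apply]
  have hf : f x = ∑' k, T k x := rfl
  have hTnn : ∀ k, 0 ≤ T k x := fun k => by
    simp only [T, hb, smul_eq_mul]
    have := b₀.nonneg' (x - n k)
    positivity
  have hTk : T k x = ((1 + (n k : ℝ)) ^ k)⁻¹ := by
    have : b₀ (x - n k) = 1 := b₀.one_of_mem_closedBall (by
      simp only [Metric.mem_closedBall, dist_zero_right, Real.norm_eq_abs, b₀]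
      rw [abs_le]; constructor <;> linarith [hx.1, hx.2])
    simp [T, hb, this]
  have hsT : Summable fun k => T k x := by
    refine (hsum 0 0).of_nonneg_of_le hTnn fun k => ?_
    have := hC0 0 k x
    rw [norm_iteratedFDeriv_zero] at this
    exact (Real.le_norm_self _).trans this
  have : T k x ≤ f x := hsT.le_tsum k fun i _ => hTnn i
  rw [Complex.ofRealCLM_apply, Complex.norm_real, ← hTk]
  exact this.trans (Real.le_norm_self _)

/-- A gliding hump: if the masses of `φ` on unit intervals grew faster than every polynomial, a
Schwartz function that is large enough on a sparse sequence of these intervals would make `f φ`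
non-integrable. -/
lemma exists_isWeighted {φ : ℝ → X} (hloc : LocallyIntegrable φ volume)
    (hint : ∀ f : 𝓢(ℝ, ℂ), Integrable (fun t => f t • φ t) volume) (h0 : ∀ t < 0, φ t = 0) :
    ∃ k, IsWeighted k φ := by
  have hI : ∀ n : ℕ, IntegrableOn φ (Ico (n : ℝ) (n + 1)) := fun n =>
    (hloc.integrableOn_isCompact isCompact_Icc).mono_set Ico_subset_Icc_self
  set a : ℕ → ℝ := fun n => ∫ t in Ico (n : ℝ) (n + 1), ‖φ t‖
  have key : ∃ k : ℕ, ∀ᶠ n in atTop, a n ≤ (n : ℝ) * (1 + n) ^ k := by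
    -- Failure yields a strictly increasing `n` with `a (n k) > n k * (1 + n k) ^ k`. The extra
    -- factor `n k ≥ k` lets the mass of `f φ` on the `k`-th interval exceed any bound.
    by_contra! hcon
    have hcon' : ∀ k : ℕ, ∃ᶠ n : ℕ in atTop, (n : ℝ) * (1 + n) ^ k < a n := by
      intro k
      have := hcon k
      simpa [Filter.Frequently] using this
    obtain ⟨n, hn, hna⟩ := extraction_forall_of_frequently hcon'
    obtain ⟨f, hf⟩ := exists_schwartz_ge hn
    have hfi := (hint f).norm
    obtain ⟨k, hk⟩ := exists_nat_gt (∫ t, ‖f t • φ t‖)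
    have h1 : ((1 + (n k : ℝ)) ^ k)⁻¹ * a (n k) ≤ ∫ t, ‖f t • φ t‖ := by
      calc ((1 + (n k : ℝ)) ^ k)⁻¹ * a (n k)
          = ∫ t in Ico (n k : ℝ) (n k + 1), ((1 + (n k : ℝ)) ^ k)⁻¹ * ‖φ t‖ := by
            rw [integral_const_mul]
        _ ≤ ∫ t in Ico (n k : ℝ) (n k + 1), ‖f t • φ t‖ := by
            refine setIntegral_mono_on ((hI _).norm.const_mul _) hfi.integrableOn
              measurableSet_Ico fun t ht => ?_
            rw [norm_smul]
            gcongr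
            exact hf k t (Ico_subset_Icc_self ht)
        _ ≤ _ := setIntegral_le_integral hfi (ae_of_all _ fun _ => norm_nonneg _)
    have h2 := hna k
    rw [inv_mul_le_iff₀ (by positivity)] at h1
    have h3 : (k : ℝ) ≤ n k := by exact_mod_cast hn.id_le k
    have h4 : (0 : ℝ) < (1 + n k) ^ k := by positivity
    nlinarith
  obtain ⟨k, hk⟩ := key
  -- One extra power absorbs the factor `n` in the bound on `a n`, and two more make the sum over
  -- the unit intervals converge.
  refine ⟨k + 3, hloc.aestronglyMeasurable, ?_⟩
  have hmeas : AEStronglyMeasurable (fun t : ℝ => ((1 + |t|) ^ (k + 3))⁻¹ * ‖φ t‖) volume := by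
    refine AEStronglyMeasurable.mul (Continuous.aestronglyMeasurable ?_)
      hloc.aestronglyMeasurable.norm
    exact Continuous.inv₀ (by fun_prop) fun t => by positivity
  have hw : ∀ n : ℕ, ∀ t ∈ Ico (n : ℝ) (n + 1), ‖((1 + |t|) ^ (k + 3))⁻¹ * ‖φ t‖‖ ≤
      ((1 + (n : ℝ)) ^ (k + 3))⁻¹ * ‖φ t‖ := by
    intro n t ht
    rw [Real.norm_of_nonneg (by positivity)]
    gcongr
    exact ht.1.trans (le_abs_self t)
  have hIn : ∀ n : ℕ, IntegrableOn (fun t : ℝ => ((1 + |t|) ^ (k + 3))⁻¹ * ‖φ t‖)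
      (Ico (n : ℝ) (n + 1)) := fun n =>
    Integrable.mono' ((hI n).norm.const_mul _) hmeas.restrict
      ((ae_restrict_iff' measurableSet_Ico).2 (ae_of_all _ (hw n)))
  have hIoi : IntegrableOn (fun t : ℝ => ((1 + |t|) ^ (k + 3))⁻¹ * ‖φ t‖)
      (⋃ n : ℕ, Ico (n : ℝ) (n + 1)) := by
    refine integrableOn_iUnion_of_summable_integral_norm hIn ?_
    have h2 : Summable fun n : ℕ => (((n + 1 : ℕ) : ℝ) ^ 2)⁻¹ :=
      (summable_nat_add_iff 1).2 (Real.summable_nat_pow_inv.2 one_lt_two)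
    refine h2.of_norm_bounded_eventually_nat ?_
    filter_upwards [hk] with n hn
    rw [Real.norm_of_nonneg (integral_nonneg fun _ => norm_nonneg _)]
    calc _ ≤ ∫ t in Ico (n : ℝ) (n + 1), ((1 + (n : ℝ)) ^ (k + 3))⁻¹ * ‖φ t‖ :=
          setIntegral_mono_on (hIn n).norm ((hI n).norm.const_mul _) measurableSet_Ico (hw n)
      _ = ((1 + (n : ℝ)) ^ (k + 3))⁻¹ * a n := by rw [integral_const_mul]
      _ ≤ ((1 + (n : ℝ)) ^ (k + 3))⁻¹ * ((1 + n) * (1 + n) ^ k) := by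
          gcongr
          refine hn.trans ?_
          gcongr
          linarith
      _ = (((n + 1 : ℕ) : ℝ) ^ 2)⁻¹ := by
          push_cast
          have : (1 + (n : ℝ)) ≠ 0 := by positivity
          rw [add_comm (n : ℝ) 1]
          field_simp
          ring
  have hsupp : Function.support (fun t : ℝ => ((1 + |t|) ^ (k + 3))⁻¹ * ‖φ t‖) ⊆
      ⋃ n : ℕ, Ico (n : ℝ) (n + 1) := by
    intro t ht
    have ht0 : 0 ≤ t := by
      by_contra h
      exact ht (by simp [h0 t (not_le.1 h)])
    exact mem_iUnion.2 ⟨⌊t⌋₊, Nat.floor_le ht0, Nat.lt_floor_add_one t⟩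
  exact (integrableOn_iff_integrable_of_support_subset hsupp).1 hIoi

/-! ### Schwartz decay and the Fourier normalisation -/

lemma schwartz_norm_le (f : 𝓢(ℝ, ℂ)) (m : ℕ) :
    ∃ C, 0 ≤ C ∧ ∀ x, ‖f x‖ ≤ C * ((1 + |x|) ^ m)⁻¹ := by
  refine ⟨2 ^ m * ((Finset.Iic (m, 0)).sup fun m => SchwartzMap.seminorm ℝ m.1 m.2) f,
    by positivity, fun x => ?_⟩
  have := SchwartzMap.one_add_le_sup_seminorm_apply (𝕜 := ℝ) (m := (m, 0)) le_rfl le_rfl f x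
  rw [norm_iteratedFDeriv_zero, Real.norm_eq_abs] at this
  rw [← div_eq_mul_inv, le_div_iff₀ (by positivity), mul_comm]
  exact this

lemma IsWeighted.integrable_smul {k : ℕ} {φ : ℝ → X} (hφ : IsWeighted k φ) {g : ℝ → ℂ}
    {s : Set ℝ} (hs : MeasurableSet s) (hg : AEStronglyMeasurable g (volume.restrict s)) {C : ℝ}
    (hC : ∀ t ∈ s, ‖g t‖ ≤ C * ((1 + |t|) ^ k)⁻¹) :
    IntegrableOn (fun t => g t • φ t) s volume := by
  refine Integrable.mono' (hφ.integrable_weight.const_mul C).integrableOn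
    (hg.smul hφ.aestronglyMeasurable.restrict)
    ((ae_restrict_iff' hs).2 (ae_of_all _ fun t ht => ?_))
  rw [norm_smul, ← mul_assoc]
  gcongr
  exact hC t ht

lemma IsWeighted.integrable_schwartz_smul {k : ℕ} {φ : ℝ → X} (hφ : IsWeighted k φ)
    (f : 𝓢(ℝ, ℂ)) : Integrable (fun t => f t • φ t) volume := by
  obtain ⟨C, -, hC⟩ := schwartz_norm_le f k
  rw [← integrableOn_univ]
  exact hφ.integrable_smul MeasurableSet.univ f.continuous.aestronglyMeasurable
    fun t _ => hC t

lemma fourierHat_eq_fourier (f : ℝ → ℂ) (ω : ℝ) :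
    fourierHat f ω = FourierTransform.fourier f (ω / (2 * Real.pi)) := by
  rw [Real.fourier_real_eq_integral_exp_smul, fourierHat]
  congr 1
  ext t
  rw [smul_eq_mul]
  congr 2
  push_cast
  have : (Real.pi : ℂ) ≠ 0 := by exact_mod_cast Real.pi_ne_zero
  field_simp

/-- The Fourier transform `∫ e^{-i ω t} f(t) dt` as a map of the Schwartz space into itself. -/
def schwartzHat (f : 𝓢(ℝ, ℂ)) : 𝓢(ℝ, ℂ) :=
  SchwartzMap.compCLMOfContinuousLinearEquiv ℂ
    (ContinuousLinearEquiv.unitsEquivAut ℝ (Units.mk0 (2 * Real.pi)⁻¹ (by positivity)))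
    (FourierTransform.fourier f)

lemma schwartzHat_apply (f : 𝓢(ℝ, ℂ)) (ω : ℝ) : schwartzHat f ω = fourierHat f ω := by
  rw [fourierHat_eq_fourier, ← SchwartzMap.fourier_coe]
  simp [schwartzHat, div_eq_mul_inv]

lemma coe_schwartzHat (f : 𝓢(ℝ, ℂ)) : ⇑(schwartzHat f) = fourierHat f :=
  funext (schwartzHat_apply f)

/-- Fourier inversion in the `e^{-iωt}` normalisation; the factor `2π` is the Jacobian of the
rescaling to Mathlib's convention. -/
lemma fourierHat_fourierHat_neg (f : 𝓢(ℝ, ℂ)) (ω : ℝ) :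
    fourierHat (fun t => fourierHat f (-t)) ω = 2 * Real.pi * f ω := by
  have hpi : (0 : ℝ) < 2 * Real.pi := by positivity
  have h1 : ∀ t : ℝ, fourierHat f (-t) =
      (FourierTransformInv.fourierInv f : 𝓢(ℝ, ℂ)) (t / (2 * Real.pi)) := by
    intro t
    rw [fourierHat_eq_fourier, SchwartzMap.fourierInv_coe, Real.fourierInv_eq_fourier_neg, neg_div]
  have h2 : f ω = FourierTransform.fourier
      ⇑(FourierTransformInv.fourierInv f : 𝓢(ℝ, ℂ)) ω := by
    rw [← SchwartzMap.fourier_coe, FourierTransform.fourier_fourierInv_eq]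
  rw [h2, Real.fourier_real_eq_integral_exp_smul, fourierHat]
  simp_rw [h1]
  set F : 𝓢(ℝ, ℂ) := FourierTransformInv.fourierInv f
  have h3 := Measure.integral_comp_div (fun t : ℝ => Complex.exp (-(Complex.I * ω *
    ((2 * Real.pi * t : ℝ) : ℂ))) * F t) (2 * Real.pi)
  have h4 : ∀ t : ℝ, 2 * Real.pi * (t / (2 * Real.pi)) = t := fun t => mul_div_cancel₀ t hpi.ne'
  simp_rw [h4] at h3
  rw [h3, abs_of_pos hpi, Complex.real_smul]
  push_cast
  congr 1
  refine integral_congr_ae (ae_of_all _ fun t => ?_)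
  simp only [smul_eq_mul]
  congr 2
  ring

/-! ### Boundary values of the Laplace transform -/

lemma norm_exp_neg_mul (a s t : ℝ) :
    ‖Complex.exp (-(a + Complex.I * s) * t)‖ = Real.exp (-(a * t)) := by
  rw [Complex.norm_exp]
  simp

lemma norm_exp_neg_I_mul (s t : ℝ) : ‖Complex.exp (-(Complex.I * s * t))‖ = 1 := by
  rw [Complex.norm_exp]
  simp

lemma exp_neg_mul_le (k : ℕ) {a : ℝ} (ha : 0 < a) :
    ∃ C, ∀ t ∈ Ioi (0 : ℝ), Real.exp (-(a * t)) ≤ C * ((1 + |t|) ^ k)⁻¹ := by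
  refine ⟨Real.exp a * k.factorial / a ^ k, fun t ht => ?_⟩
  have ht : 0 < t := ht
  have h := Real.pow_div_factorial_le_exp (a * (1 + t)) (by positivity) k
  rw [abs_of_pos ht, ← div_eq_mul_inv, le_div_iff₀ (by positivity), le_div_iff₀ (by positivity)]
  rw [div_le_iff₀ (by positivity), mul_pow, mul_add, mul_one, Real.exp_add] at h
  have h2 : Real.exp (-(a * t)) * Real.exp (a * t) = 1 := by rw [← Real.exp_add]; simp
  calc _ = Real.exp (-(a * t)) * (a ^ k * (1 + t) ^ k) := by ring
    _ ≤ Real.exp (-(a * t)) * (Real.exp a * Real.exp (a * t) * k.factorial) := by gcongr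
    _ = (Real.exp (-(a * t)) * Real.exp (a * t)) * (Real.exp a * k.factorial) := by ring
    _ = _ := by rw [h2, one_mul]

lemma IsWeighted.integrableOn_exp_norm {k : ℕ} {φ : ℝ → X} (hφ : IsWeighted k φ) {a : ℝ}
    (ha : 0 < a) : IntegrableOn (fun t => Real.exp (-(a * t)) * ‖φ t‖) (Ioi 0) volume := by
  obtain ⟨C, hC⟩ := exp_neg_mul_le k ha
  have h := hφ.integrable_smul (g := fun t : ℝ => (Real.exp (-(a * t)) : ℂ)) measurableSet_Ioi
    (Continuous.aestronglyMeasurable (by fun_prop)) (C := C)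
    (fun t ht => by
      rw [Complex.norm_real, Real.norm_of_nonneg (Real.exp_nonneg _)]
      exact hC t ht)
  refine h.norm.congr (ae_of_all _ fun t => ?_)
  simp only [norm_smul, Complex.norm_real, Real.norm_of_nonneg (Real.exp_nonneg _)]

/-- The damping `e^{-at}` makes the double integral absolutely convergent, so Fubini moves the
integration in `s` onto `u`, where it produces `û`. -/
lemma IsWeighted.integral_smul_laplace [CompleteSpace X] {k : ℕ} {φ : ℝ → X}
    (hφ : IsWeighted k φ) (u : 𝓢(ℝ, ℂ)) {a : ℝ} (ha : 0 < a) :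
    ∫ s, u s • laplace φ (a + Complex.I * s) =
      ∫ t in Ioi (0 : ℝ), Complex.exp (-(a * t)) • fourierHat u t • φ t := by
  have hint : Integrable (Function.uncurry fun s t : ℝ =>
      u s • Complex.exp (-(a + Complex.I * s) * t) • φ t)
      (volume.prod (volume.restrict (Ioi 0))) := by
    refine Integrable.mono' (u.integrable.norm.mul_prod (hφ.integrableOn_exp_norm ha)) ?_
      (ae_of_all _ fun p => ?_)
    · refine AEStronglyMeasurable.smul (Continuous.aestronglyMeasurable ?_)
        (AEStronglyMeasurable.smul (Continuous.aestronglyMeasurable ?_)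
          hφ.aestronglyMeasurable.restrict.comp_snd)
      · exact u.continuous.comp continuous_fst
      · fun_prop
    · simp only [Function.uncurry]
      rw [norm_smul, norm_smul, norm_exp_neg_mul]
  calc _ = ∫ s, ∫ t in Ioi (0 : ℝ), u s • Complex.exp (-(a + Complex.I * s) * t) • φ t := by
        simp_rw [laplace, integral_smul]
    _ = ∫ t in Ioi (0 : ℝ), ∫ s, u s • Complex.exp (-(a + Complex.I * s) * t) • φ t :=
        integral_integral_swap hint
    _ = _ := by
        congr 1
        ext t
        rw [smul_smul, fourierHat, ← integral_const_mul, ← integral_smul_const]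
        congr 1
        ext s
        rw [smul_smul, ← mul_assoc, ← Complex.exp_add, mul_comm]
        congr 3
        ring

/-- The boundary values of the Laplace transform are the Fourier transform on the half-line. -/
lemma IsWeighted.tendsto_integral_smul_laplace [CompleteSpace X] {k : ℕ} {φ : ℝ → X}
    (hφ : IsWeighted k φ) (u : 𝓢(ℝ, ℂ)) :
    Tendsto (fun a : ℝ => ∫ s, u s • laplace φ (a + Complex.I * s)) (𝓝[>] 0)
      (𝓝 (∫ t in Ioi (0 : ℝ), fourierHat u t • φ t)) := by
  have hi : Integrable (fun t => fourierHat u t • φ t) volume := by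
    simpa only [schwartzHat_apply] using hφ.integrable_schwartz_smul (schwartzHat u)
  refine Tendsto.congr' (f₁ := fun a : ℝ => ∫ t in Ioi (0 : ℝ),
    Complex.exp (-(a * t)) • fourierHat u t • φ t) ?_ ?_
  · filter_upwards [self_mem_nhdsWithin] with a ha
    exact (hφ.integral_smul_laplace u ha).symm
  refine tendsto_integral_filter_of_dominated_convergence (fun t => ‖fourierHat u t • φ t‖)
    (Eventually.of_forall fun a => ?_) ?_ hi.norm.integrableOn (ae_of_all _ fun t => ?_)
  · exact AEStronglyMeasurable.smul (Continuous.aestronglyMeasurable (by fun_prop))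
      hi.aestronglyMeasurable.restrict
  · filter_upwards [self_mem_nhdsWithin] with a ha
    refine (ae_restrict_iff' measurableSet_Ioi).2 (ae_of_all _ fun t ht => ?_)
    rw [norm_smul, Complex.norm_exp]
    have : Real.exp (-(a * t : ℂ)).re ≤ 1 := by
      rw [Real.exp_le_one_iff]
      have : 0 < a * t := mul_pos ha ht
      simp [this.le]
    exact mul_le_of_le_one_left (norm_nonneg _) this
  · have : Tendsto (fun a : ℝ => Complex.exp (-(a * t)) • fourierHat u t • φ t) (𝓝 0)
        (𝓝 (Complex.exp (-((0 : ℝ) * t)) • fourierHat u t • φ t)) :=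
      Continuous.tendsto (by fun_prop) 0
    simpa using this.mono_left nhdsWithin_le_nhds

/-! ### Tempered functions and their convolutions with Schwartz functions -/

lemma integrable_inv_one_add_abs_sq : Integrable (fun t : ℝ => ((1 + |t|) ^ 2)⁻¹) volume := by
  refine integrable_inv_one_add_sq.mono' (Continuous.aestronglyMeasurable
    (Continuous.inv₀ (by fun_prop) fun t => by positivity)) (ae_of_all _ fun t => ?_)
  rw [Real.norm_of_nonneg (by positivity)]
  gcongr
  nlinarith [abs_nonneg t, sq_abs t]

lemma IsWeighted.isTemperedFun {k : ℕ} {ψ : ℝ → X} (hψ : IsWeighted k ψ)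
    (hloc : LocallyIntegrable ψ volume) : IsTemperedFun ψ := by
  refine ⟨hloc, hψ.integrable_schwartz_smul, ?_⟩
  let A : 𝓢(ℝ, ℂ) →L[ℂ] X := SchwartzMap.mkCLMtoNormedSpace (fun f => ∫ t, f t • ψ t)
    (fun f g => by
      rw [← integral_add (hψ.integrable_schwartz_smul f) (hψ.integrable_schwartz_smul g)]
      simp only [add_apply, add_smul])
    (fun a f => by
      rw [RingHom.id_apply, ← integral_smul]
      simp only [smul_apply, smul_assoc])
    ⟨Finset.Iic (k, 0), 2 ^ k * ∫ t, ((1 + |t|) ^ k)⁻¹ * ‖ψ t‖,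
      mul_nonneg (by positivity) (integral_nonneg fun t => by positivity), fun f => by
      rw [mul_assoc, mul_comm (∫ t, ((1 + |t|) ^ k)⁻¹ * ‖ψ t‖), ← mul_assoc, ← integral_const_mul]
      refine norm_integral_le_of_norm_le (hψ.integrable_weight.const_mul _)
        (ae_of_all _ fun t => ?_)
      have := SchwartzMap.one_add_le_sup_seminorm_apply (𝕜 := ℂ) (m := (k, 0)) le_rfl le_rfl f t
      rw [norm_iteratedFDeriv_zero, Real.norm_eq_abs] at this
      rw [norm_smul, ← mul_assoc]
      gcongr
      rw [← div_eq_mul_inv, le_div_iff₀ (by positivity), mul_comm]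
      exact this⟩
  exact ⟨ContinuousLinearMap.toPointwiseConvergenceCLM _ _ _ _ A, fun f => rfl⟩

lemma isWeighted_of_norm_le {Y : Type*} [NormedAddCommGroup Y] {ψ : ℝ → Y}
    (hm : AEStronglyMeasurable ψ volume) {C : ℝ} {k : ℕ}
    (hC : ∀ᵐ t, ‖ψ t‖ ≤ C * (1 + |t|) ^ k) : IsWeighted (k + 2) ψ := by
  refine ⟨hm, (integrable_inv_one_add_abs_sq.const_mul C).mono' ?_ ?_⟩
  · exact (Continuous.aestronglyMeasurable
      (Continuous.inv₀ (by fun_prop) fun t => by positivity)).mul hm.norm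
  · filter_upwards [hC] with t ht
    rw [Real.norm_of_nonneg (by positivity)]
    calc _ ≤ ((1 + |t|) ^ (k + 2))⁻¹ * (C * (1 + |t|) ^ k) := by gcongr
      _ = _ := by
        rw [pow_add]
        field_simp

lemma conv_apply (φ : ℝ → X) (f : ℝ → ℂ) (t : ℝ) : conv φ f t = ∫ r, f (t - r) • φ r :=
  convolution_lsmul_swap

lemma inv_one_add_abs_sub_le (t r : ℝ) (k : ℕ) :
    ((1 + |t - r|) ^ k)⁻¹ ≤ (1 + |t|) ^ k * ((1 + |r|) ^ k)⁻¹ := by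
  rw [← div_eq_mul_inv, le_div_iff₀ (by positivity), inv_mul_le_iff₀ (by positivity), ← mul_pow]
  gcongr
  have : |r| ≤ |t| + |t - r| := by
    calc |r| = |t - (t - r)| := by ring_nf
      _ ≤ _ := abs_sub _ _
  nlinarith [abs_nonneg t, abs_nonneg (t - r)]

lemma schwartz_sub_norm_le (f : 𝓢(ℝ, ℂ)) (k : ℕ) :
    ∃ C, 0 ≤ C ∧ ∀ t r, ‖f (t - r)‖ ≤ C * (1 + |t|) ^ k * ((1 + |r|) ^ k)⁻¹ := by
  obtain ⟨C, hC0, hC⟩ := schwartz_norm_le f k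
  refine ⟨C, hC0, fun t r => (hC _).trans ?_⟩
  rw [mul_assoc]
  gcongr
  exact inv_one_add_abs_sub_le t r k

lemma IsWeighted.norm_conv_le {k : ℕ} {φ : ℝ → X} (hφ : IsWeighted k φ) (f : 𝓢(ℝ, ℂ)) :
    ∃ C, ∀ t, ‖conv φ f t‖ ≤ C * (1 + |t|) ^ k := by
  obtain ⟨C, hC0, hC⟩ := schwartz_sub_norm_le f k
  refine ⟨C * ∫ r, ((1 + |r|) ^ k)⁻¹ * ‖φ r‖, fun t => ?_⟩
  rw [conv_apply, mul_right_comm, ← integral_const_mul]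
  refine norm_integral_le_of_norm_le (hφ.integrable_weight.const_mul _) (ae_of_all _ fun r => ?_)
  rw [norm_smul, ← mul_assoc]
  gcongr
  exact hC t r

lemma IsWeighted.continuous_conv {k : ℕ} {φ : ℝ → X} (hφ : IsWeighted k φ) (f : 𝓢(ℝ, ℂ)) :
    Continuous (conv φ f) := by
  obtain ⟨C, hC0, hC⟩ := schwartz_sub_norm_le f k
  have h : conv φ f = fun t => ∫ r, f (t - r) • φ r := funext (conv_apply φ f)
  rw [h, continuous_iff_continuousAt]
  intro t
  refine continuousAt_of_dominated
    (bound := fun r => C * (2 + |t|) ^ k * (((1 + |r|) ^ k)⁻¹ * ‖φ r‖))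
    (Eventually.of_forall fun s => ?_) ?_ (hφ.integrable_weight.const_mul _)
    (ae_of_all _ fun r => ?_)
  · exact (f.continuous.comp (by fun_prop)).aestronglyMeasurable.smul hφ.aestronglyMeasurable
  · filter_upwards [Metric.ball_mem_nhds t one_pos] with s hs
    refine ae_of_all _ fun r => ?_
    rw [norm_smul, ← mul_assoc]
    gcongr
    refine (hC s r).trans ?_
    rw [Metric.mem_ball, Real.dist_eq] at hs
    have h2 : 1 + |s| ≤ 2 + |t| := by linarith [abs_sub_abs_le_abs_sub s t]
    exact mul_le_mul_of_nonneg_right (mul_le_mul_of_nonneg_left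
      (pow_le_pow_left₀ (by positivity) h2 k) hC0) (by positivity)
  · exact ((f.continuous.comp (by fun_prop : Continuous fun s : ℝ => s - r)).smul
      continuous_const).continuousAt

/-- For `t ≤ 0 ≤ r` there is no cancellation: `|t - r| = |t| + |r|`. Decay of `f` of order `k + 2`
therefore splits into `k` powers for the weight of `φ` and two for integrability in `t`. -/
lemma IsWeighted.norm_conv_le_of_nonpos {k : ℕ} {φ : ℝ → X} (hφ : IsWeighted k φ)
    (h0 : ∀ t < 0, φ t = 0) (f : 𝓢(ℝ, ℂ)) :
    ∃ C, ∀ t ≤ 0, ‖conv φ f t‖ ≤ C * ((1 + |t|) ^ 2)⁻¹ := by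
  obtain ⟨C, hC0, hC⟩ := schwartz_norm_le f (k + 2)
  refine ⟨C * ∫ r, ((1 + |r|) ^ k)⁻¹ * ‖φ r‖, fun t ht => ?_⟩
  rw [conv_apply, mul_right_comm, ← integral_const_mul]
  refine norm_integral_le_of_norm_le (hφ.integrable_weight.const_mul _) (ae_of_all _ fun r => ?_)
  rcases lt_or_ge r 0 with hr | hr
  · simp [h0 r hr]
  rw [norm_smul, ← mul_assoc]
  gcongr
  refine (hC _).trans ?_
  rw [mul_assoc]
  gcongr
  have h1 : |t - r| = |t| + |r| := by
    rw [abs_of_nonpos (by linarith : t - r ≤ 0), abs_of_nonpos ht, abs_of_nonneg hr]; ring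
  rw [h1, ← mul_inv, add_comm k 2, pow_add]
  gcongr
  · linarith [abs_nonneg r]
  · linarith [abs_nonneg t]

lemma IsWeighted.isWeighted_conv {k : ℕ} {φ : ℝ → X} (hφ : IsWeighted k φ) (f : 𝓢(ℝ, ℂ)) :
    IsWeighted (k + 2) (conv φ f) := by
  obtain ⟨C, hC⟩ := hφ.norm_conv_le f
  exact isWeighted_of_norm_le (hφ.continuous_conv f).aestronglyMeasurable (ae_of_all _ hC)

lemma IsWeighted.integral_schwartz_smul_conv [CompleteSpace X] {k : ℕ} {φ : ℝ → X} (hφ : IsWeighted k φ)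
    (f g : 𝓢(ℝ, ℂ)) :
    ∫ t, g t • conv φ f t = ∫ r, (∫ t, g t * f (t - r)) • φ r := by
  obtain ⟨C, hC0, hC⟩ := schwartz_sub_norm_le f k
  -- Of the `k + 2` powers, `k` compensate the growth in `t` from the bound on `f (t - r)`, and two
  -- remain for integrability.
  obtain ⟨D, hD0, hD⟩ := schwartz_norm_le g (k + 2)
  have hint : Integrable (Function.uncurry fun t r : ℝ => g t • f (t - r) • φ r)
      (volume.prod volume) := by
    refine Integrable.mono' ((integrable_inv_one_add_abs_sq.const_mul (D * C)).mul_prod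
      hφ.integrable_weight) ?_ (ae_of_all _ fun p => ?_)
    · refine AEStronglyMeasurable.smul (Continuous.aestronglyMeasurable ?_)
        (AEStronglyMeasurable.smul (Continuous.aestronglyMeasurable ?_)
          hφ.aestronglyMeasurable.comp_snd)
      · exact g.continuous.comp continuous_fst
      · exact f.continuous.comp (by fun_prop)
    · simp only [Function.uncurry]
      rw [norm_smul, norm_smul, ← mul_assoc, ← mul_assoc]
      refine mul_le_mul_of_nonneg_right ?_ (norm_nonneg _)
      calc _ ≤ (D * ((1 + |p.1|) ^ (k + 2))⁻¹) *
            (C * (1 + |p.1|) ^ k * ((1 + |p.2|) ^ k)⁻¹) := by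
            gcongr
            · exact hD _
            · exact hC _ _
        _ = _ := by
            rw [pow_add]
            field_simp
  calc _ = ∫ t, ∫ r, g t • f (t - r) • φ r := by simp_rw [conv_apply, integral_smul]
    _ = ∫ r, ∫ t, g t • f (t - r) • φ r := integral_integral_swap hint
    _ = _ := by
      congr 1
      ext r
      rw [← integral_smul_const]
      simp_rw [smul_smul]

/-- The convolution theorem in transposed form: pairing `φ ∗ f` with `û` is pairing `φ` with the
transform of `u f̂`. -/
lemma integral_fourierHat_mul_sub (u f : 𝓢(ℝ, ℂ)) (r : ℝ) :
    ∫ t, fourierHat u t * f (t - r) = fourierHat (fun y => u y * fourierHat f y) r := by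
  have hint : Integrable (Function.uncurry fun t y : ℝ =>
      Complex.exp (-(Complex.I * t * y)) * u y * f (t - r)) (volume.prod volume) := by
    refine Integrable.mono' ((f.integrable.comp_sub_right r).norm.mul_prod u.integrable.norm) ?_
      (ae_of_all _ fun p => ?_)
    · refine Continuous.aestronglyMeasurable ?_
      have h1 : Continuous fun p : ℝ × ℝ => u p.2 := u.continuous.comp continuous_snd
      have h2 : Continuous fun p : ℝ × ℝ => f (p.1 - r) := f.continuous.comp (by fun_prop)
      exact (Continuous.mul (by fun_prop) h1).mul h2
    · simp only [Function.uncurry]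
      rw [norm_mul, norm_mul, norm_exp_neg_I_mul, one_mul, mul_comm]
  calc _ = ∫ t : ℝ, ∫ y : ℝ, Complex.exp (-(Complex.I * t * y)) * u y * f (t - r) := by
        simp_rw [integral_mul_const, fourierHat]
    _ = ∫ y : ℝ, ∫ t : ℝ, Complex.exp (-(Complex.I * t * y)) * u y * f (t - r) :=
        integral_integral_swap hint
    _ = _ := by
        rw [fourierHat]
        congr 1
        ext y
        have h := integral_sub_right_eq_self (μ := volume) (fun t : ℝ =>
          Complex.exp (-(Complex.I * (t + r : ℝ) * y)) * u y * f t) r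
        simp only [sub_add_cancel] at h
        rw [h, fourierHat, ← mul_assoc, ← integral_const_mul]
        congr 1
        ext t
        rw [show -(Complex.I * ((t + r : ℝ) : ℂ) * y) =
          -(Complex.I * r * y) + -(Complex.I * y * t) by push_cast; ring, Complex.exp_add]
        ring

lemma IsWeighted.integral_fourierHat_smul_conv [CompleteSpace X] {k : ℕ} {φ : ℝ → X} (hφ : IsWeighted k φ)
    (u f : 𝓢(ℝ, ℂ)) :
    ∫ t, fourierHat u t • conv φ f t =
      ∫ r, fourierHat (fun y => u y * fourierHat f y) r • φ r := by
  simp_rw [← integral_fourierHat_mul_sub, ← schwartzHat_apply u]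
  exact hφ.integral_schwartz_smul_conv f (schwartzHat u)

/-! ### Weak regular points and convolution -/

/-- Weak regularity of the Laplace transform says that the Fourier transform of `φ` on the
half-line is an integrable function near `ω`. -/
lemma IsWeighted.isWeakRegularPoint_iff [CompleteSpace X] {k : ℕ} {φ : ℝ → X}
    (hφ : IsWeighted k φ) {ω : ℝ} :
    IsWeakRegularPoint (laplace φ) ω ↔
      ∃ ε > 0, ∃ h : ℝ → X, IntegrableOn h (Ioo (ω - ε) (ω + ε)) volume ∧
        ∀ u : ℝ → ℂ, ContDiff ℝ ((⊤ : ℕ∞) : WithTop ℕ∞) u → HasCompactSupport u →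
          tsupport u ⊆ Ioo (ω - ε) (ω + ε) →
          ∫ t in Ioi (0 : ℝ), fourierHat u t • φ t = ∫ s in Ioo (ω - ε) (ω + ε), u s • h s := by
  have key : ∀ u : ℝ → ℂ, ContDiff ℝ ((⊤ : ℕ∞) : WithTop ℕ∞) u → HasCompactSupport u →
      Tendsto (fun a : ℝ => ∫ s, u s • laplace φ (a + Complex.I * s)) (𝓝[>] 0)
        (𝓝 (∫ t in Ioi (0 : ℝ), fourierHat u t • φ t)) := fun u h1 h2 =>
    hφ.tendsto_integral_smul_laplace (h2.toSchwartzMap h1)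
  constructor
  · rintro ⟨ε, hε, h, hi, H⟩
    exact ⟨ε, hε, h, hi, fun u h1 h2 h3 =>
      tendsto_nhds_unique (key u h1 h2) (H u h1 h2 h3)⟩
  · rintro ⟨ε, hε, h, hi, H⟩
    refine ⟨ε, hε, h, hi, fun u h1 h2 h3 => ?_⟩
    rw [← H u h1 h2 h3]
    exact key u h1 h2

lemma eq_zero_of_notMem_of_tsupport_subset {u : ℝ → ℂ} {s : Set ℝ} (h : tsupport u ⊆ s) {x : ℝ}
    (hx : x ∉ s) : u x = 0 :=
  image_eq_zero_of_notMem_tsupport fun h' => hx (h h')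

lemma setIntegral_Ioi_eq_integral {φ : ℝ → X} (h0 : ∀ t < 0, φ t = 0) (g : ℝ → ℂ) :
    ∫ t in Ioi (0 : ℝ), g t • φ t = ∫ t, g t • φ t := by
  rw [← integral_Ici_eq_integral_Ioi]
  exact setIntegral_eq_integral_of_forall_compl_eq_zero fun t ht => by
    rw [h0 t (by simpa using ht), smul_zero]

lemma continuous_setIntegral_exp_smul {ψ : ℝ → X} {s : Set ℝ} (hψ : IntegrableOn ψ s volume) :
    Continuous fun y : ℝ => ∫ t in s, Complex.exp (-(Complex.I * y * t)) • ψ t := by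
  refine continuous_of_dominated (bound := fun t => ‖ψ t‖) (fun y => ?_) (fun y => ?_) hψ.norm
    (ae_of_all _ fun t => by fun_prop)
  · exact AEStronglyMeasurable.smul (Continuous.aestronglyMeasurable (by fun_prop))
      hψ.aestronglyMeasurable
  · refine ae_of_all _ fun t => ?_
    rw [norm_smul, norm_exp_neg_I_mul, one_mul]

lemma setIntegral_fourierHat_smul {ψ : ℝ → X} {s : Set ℝ}
    (hψ : IntegrableOn ψ s volume) (u : 𝓢(ℝ, ℂ)) [CompleteSpace X] :
    ∫ t in s, fourierHat u t • ψ t =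
      ∫ y, u y • ∫ t in s, Complex.exp (-(Complex.I * y * t)) • ψ t := by
  have hint : Integrable (Function.uncurry fun t y : ℝ =>
      (Complex.exp (-(Complex.I * t * y)) * u y) • ψ t) ((volume.restrict s).prod volume) := by
    refine Integrable.mono' (hψ.norm.mul_prod u.integrable.norm) ?_ (ae_of_all _ fun p => ?_)
    · refine AEStronglyMeasurable.smul (Continuous.aestronglyMeasurable ?_)
        hψ.aestronglyMeasurable.comp_fst
      have h1 : Continuous fun p : ℝ × ℝ => u p.2 := u.continuous.comp continuous_snd
      exact Continuous.mul (by fun_prop) h1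
    · simp only [Function.uncurry]
      rw [norm_smul, norm_mul, norm_exp_neg_I_mul, one_mul, mul_comm]
  calc _ = ∫ t in s, ∫ y : ℝ, (Complex.exp (-(Complex.I * t * y)) * u y) • ψ t := by
        simp_rw [integral_smul_const, fourierHat]
    _ = ∫ y : ℝ, ∫ t in s, (Complex.exp (-(Complex.I * t * y)) * u y) • ψ t :=
        integral_integral_swap hint
    _ = _ := by
        congr 1
        ext y
        rw [← integral_smul]
        congr 1
        ext t
        rw [smul_smul, mul_comm, mul_right_comm]

lemma IsWeighted.integrableOn_Iic_conv {k : ℕ} {φ : ℝ → X} (hφ : IsWeighted k φ)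
    (h0 : ∀ t < 0, φ t = 0) (f : 𝓢(ℝ, ℂ)) : IntegrableOn (conv φ f) (Iic 0) volume := by
  obtain ⟨C, hC⟩ := hφ.norm_conv_le_of_nonpos h0 f
  exact (integrable_inv_one_add_abs_sq.const_mul C).integrableOn.mono'
    (hφ.continuous_conv f).aestronglyMeasurable
    ((ae_restrict_iff' measurableSet_Iic).2 (ae_of_all _ hC))

/-- `H` says that `f̂ φ̂`, the Fourier transform of `φ ∗ f` on the whole line, is `h` near `ω`. The
Laplace transform only sees `t > 0`, so the transform `g` of the part on `t ≤ 0` is subtracted; it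
is continuous because that part is integrable. -/
lemma IsWeighted.isWeakRegularPoint_conv [CompleteSpace X] {k : ℕ} {φ : ℝ → X}
    (hφ : IsWeighted k φ) (h0 : ∀ t < 0, φ t = 0) (f : 𝓢(ℝ, ℂ)) {ω ε : ℝ} (hε : 0 < ε)
    {h : ℝ → X} (hh : IntegrableOn h (Ioo (ω - ε) (ω + ε)) volume)
    (H : ∀ u : ℝ → ℂ, ContDiff ℝ ((⊤ : ℕ∞) : WithTop ℕ∞) u → HasCompactSupport u →
      tsupport u ⊆ Ioo (ω - ε) (ω + ε) →
      ∫ r in Ioi (0 : ℝ), fourierHat (fun y => u y * fourierHat f y) r • φ r =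
        ∫ s in Ioo (ω - ε) (ω + ε), u s • h s) :
    IsWeakRegularPoint (laplace (conv φ f)) ω := by
  set ψ := conv φ f
  have hψ : IsWeighted (k + 2) ψ := hφ.isWeighted_conv f
  have hI : IntegrableOn ψ (Iic 0) volume := hφ.integrableOn_Iic_conv h0 f
  set g : ℝ → X := fun y => ∫ t in Iic (0 : ℝ), Complex.exp (-(Complex.I * y * t)) • ψ t
  have hgc : Continuous g := continuous_setIntegral_exp_smul hI
  have hgi : IntegrableOn g (Ioo (ω - ε) (ω + ε)) volume :=
    (hgc.continuousOn.integrableOn_compact isCompact_Icc).mono_set Ioo_subset_Icc_self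
  rw [hψ.isWeakRegularPoint_iff]
  refine ⟨ε, hε, fun y => h y - g y, hh.sub hgi, fun u h1 h2 h3 => ?_⟩
  let v : 𝓢(ℝ, ℂ) := h2.toSchwartzMap h1
  have hv : ⇑v = u := rfl
  have hui : Integrable (fun t => fourierHat u t • ψ t) volume := by
    simpa only [schwartzHat_apply, hv] using hψ.integrable_schwartz_smul (schwartzHat v)
  have e1 : ∫ t, fourierHat u t • ψ t = ∫ s in Ioo (ω - ε) (ω + ε), u s • h s := by
    rw [← H u h1 h2 h3, setIntegral_Ioi_eq_integral h0]
    exact hφ.integral_fourierHat_smul_conv v f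
  have e2 : ∫ t in Iic (0 : ℝ), fourierHat u t • ψ t =
      ∫ s in Ioo (ω - ε) (ω + ε), u s • g s := by
    rw [setIntegral_eq_integral_of_forall_compl_eq_zero (s := Ioo (ω - ε) (ω + ε)) fun s hs => by
      rw [eq_zero_of_notMem_of_tsupport_subset h3 hs, zero_smul]]
    exact setIntegral_fourierHat_smul hI v
  have e3 := integral_add_compl (measurableSet_Iic (a := (0 : ℝ))) hui
  rw [compl_Iic, e1, e2] at e3
  rw [← sub_eq_of_eq_add' e3.symm]
  have hbd : ∃ C, ∀ᵐ y ∂(volume.restrict (Ioo (ω - ε) (ω + ε))), ‖u y‖ ≤ C := by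
    obtain ⟨C, hC⟩ := h2.exists_bound_of_continuous h1.continuous
    exact ⟨C, ae_of_all _ hC⟩
  obtain ⟨C, hC⟩ := hbd
  have hum : AEStronglyMeasurable u (volume.restrict (Ioo (ω - ε) (ω + ε))) :=
    h1.continuous.aestronglyMeasurable
  rw [← integral_sub]
  · simp_rw [smul_sub]
  · exact Integrable.bdd_smul hh C hum hC
  · exact Integrable.bdd_smul hgi C hum hC

/-- Where `φ̂` is an integrable function `h`, the product is `f̂ h`; off the support of `f̂` it is
`0`. -/
theorem IsWeighted.weakLaplaceSpectrum_conv_subset [CompleteSpace X] {k : ℕ} {φ : ℝ → X}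
    (hφ : IsWeighted k φ) (h0 : ∀ t < 0, φ t = 0) (f : 𝓢(ℝ, ℂ)) :
    weakLaplaceSpectrum (conv φ f) ⊆ weakLaplaceSpectrum φ ∩ tsupport (fourierHat f) := by
  intro ω hω
  have hsm : ContDiff ℝ ((⊤ : ℕ∞) : WithTop ℕ∞) (fourierHat f) := by
    rw [← coe_schwartzHat]; exact (schwartzHat f).smooth ⊤
  refine ⟨fun hreg => hω ?_, ?_⟩
  · obtain ⟨ε, hε, h, hi, H⟩ := hφ.isWeakRegularPoint_iff.1 hreg
    refine hφ.isWeakRegularPoint_conv h0 f hε (h := fun s => fourierHat f s • h s) ?_ ?_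
    · obtain ⟨C, -, hC⟩ := schwartz_norm_le (schwartzHat f) 0
      rw [coe_schwartzHat] at hC
      exact Integrable.bdd_smul hi C hsm.continuous.aestronglyMeasurable
        (ae_of_all _ fun s => by simpa using hC s)
    · intro u h1 h2 h3
      rw [H _ (h1.mul hsm) h2.mul_right ((tsupport_mul_subset_left).trans h3)]
      simp_rw [smul_smul]
  · by_contra hmem
    have hnhds : (tsupport (fourierHat f))ᶜ ∈ 𝓝 ω :=
      (isClosed_tsupport _).isOpen_compl.mem_nhds hmem
    obtain ⟨ε, hε, hsub⟩ := Metric.mem_nhds_iff.1 hnhds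
    rw [Real.ball_eq_Ioo] at hsub
    refine hω (hφ.isWeakRegularPoint_conv h0 f hε (h := 0) integrableOn_zero ?_)
    intro u h1 h2 h3
    have : (fun y => u y * fourierHat f y) = 0 := by
      ext y
      by_cases hy : y ∈ Ioo (ω - ε) (ω + ε)
      · simp [image_eq_zero_of_notMem_tsupport (hsub hy)]
      · simp [eq_zero_of_notMem_of_tsupport_subset h3 hy]
    rw [this]
    simp [fourierHat]

/-! ### Riemann–Lebesgue at a weakly regular point -/

/-- Near a weakly regular point, convolution with a suitable Schwartz function gives a function
vanishing at infinity. -/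
theorem IsWeighted.exists_conv_mem_C0 [CompleteSpace X] {k : ℕ} {φ : ℝ → X}
    (hφ : IsWeighted k φ) (h0 : ∀ t < 0, φ t = 0) {ω : ℝ}
    (hω : IsWeakRegularPoint (laplace φ) ω) :
    ∃ f : 𝓢(ℝ, ℂ), fourierHat f ω = 1 ∧ conv φ f ∈ C0 X := by
  obtain ⟨ε, hε, h, hi, H⟩ := hφ.isWeakRegularPoint_iff.1 hω
  let b : ContDiffBump ω := ⟨ε / 4, ε / 2, by positivity, by linarith⟩
  have hbs : ContDiff ℝ ((⊤ : ℕ∞) : WithTop ℕ∞) fun y => (b y : ℂ) :=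
    Complex.ofRealCLM.contDiff.comp b.contDiff
  have hbc : HasCompactSupport fun y => (b y : ℂ) :=
    b.hasCompactSupport.comp_left (g := fun x : ℝ => (x : ℂ)) Complex.ofReal_zero
  have hbt : tsupport (fun y => (b y : ℂ)) ⊆ Ioo (ω - ε) (ω + ε) := by
    refine (tsupport_comp_subset (g := fun x : ℝ => (x : ℂ)) Complex.ofReal_zero b).trans ?_
    rw [b.tsupport_eq, ← Real.ball_eq_Ioo]
    exact Metric.closedBall_subset_ball (by simp only [b]; linarith)
  let u : 𝓢(ℝ, ℂ) := hbc.toSchwartzMap hbs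
  have hu : ∀ y, u y = b y := fun y => rfl
  -- The inverse Fourier transform of the bump, so that `f̂ = u`.
  let f : 𝓢(ℝ, ℂ) := (2 * Real.pi : ℂ)⁻¹ • SchwartzMap.compCLMOfContinuousLinearEquiv ℂ
    (ContinuousLinearEquiv.neg ℝ) (schwartzHat u)
  have hf : ∀ t, f t = (2 * Real.pi : ℂ)⁻¹ * fourierHat u (-t) := fun t => by
    rw [← schwartzHat_apply]; rfl
  have hpi : (2 * Real.pi : ℂ) ≠ 0 := by
    simp [Real.pi_ne_zero]
  refine ⟨f, ?_, (hφ.continuous_conv f).continuousOn, ?_⟩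
  · have hb1 : (b ω : ℂ) = 1 := by
      rw [b.one_of_mem_closedBall (Metric.mem_closedBall_self b.rIn_pos.le), Complex.ofReal_one]
    have h1 : fourierHat f ω = (2 * Real.pi : ℂ)⁻¹ * fourierHat (fun t => fourierHat u (-t)) ω := by
      rw [fourierHat, fourierHat, ← integral_const_mul]
      refine integral_congr_ae (ae_of_all _ fun t => ?_)
      simp only [hf]
      ring
    rw [h1, fourierHat_fourierHat_neg, hu, hb1, mul_one, inv_mul_cancel₀ hpi]
  · set w : ℝ → X := (Ioo (ω - ε) (ω + ε)).indicator fun y => u y • h y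
    have hconv : ∀ t, conv φ f t = (2 * Real.pi : ℂ)⁻¹ •
        ∫ y, Real.fourierChar (-(y * (-t / (2 * Real.pi)))) • w y := by
      intro t
      have hut : ContDiff ℝ ((⊤ : ℕ∞) : WithTop ℕ∞)
          -- Testing with `e^{ity} u(y)` gives the value at `t`: its transform at `r` is `û(r - t) =
          -- 2π f(t - r)`.
          fun y : ℝ => Complex.exp (Complex.I * t * y) * u y := by
        refine ContDiff.mul (ContDiff.cexp ?_) hbs
        exact contDiff_const.mul Complex.ofRealCLM.contDiff
      have hH := H _ hut (HasCompactSupport.mul_left hbc)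
        ((tsupport_mul_subset_right).trans hbt)
      rw [setIntegral_Ioi_eq_integral h0] at hH
      have h2 : ∀ r, f (t - r) • φ r = (2 * Real.pi : ℂ)⁻¹ •
          fourierHat (fun y : ℝ => Complex.exp (Complex.I * t * y) * u y) r • φ r := by
        intro r
        rw [hf, smul_smul]
        congr 2
        simp only [fourierHat]
        congr 1
        ext y
        rw [← mul_assoc, ← Complex.exp_add]
        congr 2
        push_cast
        ring
      rw [conv_apply]
      simp_rw [h2]
      rw [integral_smul, hH, ← integral_indicator measurableSet_Ioo]
      congr 2
      ext y
      by_cases hy : y ∈ Ioo (ω - ε) (ω + ε)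
      · simp only [w, indicator_of_mem hy]
        rw [Circle.smul_def, Real.fourierChar_apply, smul_smul]
        congr 3
        push_cast
        have : (Real.pi : ℂ) ≠ 0 := by exact_mod_cast Real.pi_ne_zero
        field_simp
      · simp only [w, indicator_of_notMem hy, smul_zero]
    have hRL := Real.tendsto_integral_exp_smul_cocompact w
    have hlim : Tendsto (fun t : ℝ => -t / (2 * Real.pi)) atTop (cocompact ℝ) := by
      refine Tendsto.mono_right (y := atBot) ?_ atBot_le_cocompact
      exact tendsto_neg_atTop_atBot.atBot_div_const (by positivity)
    have h3 := (hRL.comp hlim).const_smul (2 * Real.pi : ℂ)⁻¹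
    rw [smul_zero] at h3
    exact h3.congr fun t => (hconv t).symm

/-! ### Tauberian comparison of a function with its convolution -/

lemma exists_bound_of_mem_C0 {Y : Type*} [NormedAddCommGroup Y] {g : ℝ → Y} (hg : g ∈ C0 Y) :
    ∃ K, 0 ≤ K ∧ ∀ t ∈ Ici (0 : ℝ), ‖g t‖ ≤ K := by
  obtain ⟨R, hR⟩ := eventually_atTop.1 
    ((tendsto_zero_iff_norm_tendsto_zero.1 hg.2).eventually_lt_const one_pos)
  obtain ⟨K, hK⟩ := isCompact_Icc.exists_bound_of_continuousOn
    (hg.1.mono (Icc_subset_Ici_self : Icc 0 R ⊆ Ici 0))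
  refine ⟨max K 1, by positivity, fun t ht => ?_⟩
  rcases le_total t R with h | h
  · exact (hK t ⟨ht, h⟩).trans (le_max_left _ _)
  · exact (hR t h).le.trans (le_max_right _ _)

lemma locallyIntegrable_of_ae_bound {Y : Type*} [NormedAddCommGroup Y] {ψ : ℝ → Y}
    (hm : AEStronglyMeasurable ψ volume) {M : ℝ}
    (hM : ∀ᵐ t, ‖ψ t‖ ≤ M) : LocallyIntegrable ψ volume :=
  (memLp_top_of_bound hm M hM).locallyIntegrable le_top

/-- Only two end pieces of length `|s|` fail to cancel, so the bound does not depend on `b - a`. -/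
lemma norm_intervalIntegral_sub_translate_le {ψ : ℝ → X} (hm : AEStronglyMeasurable ψ volume)
    {M : ℝ} (hM : ∀ᵐ t, ‖ψ t‖ ≤ M) (a b s : ℝ) :
    ‖(∫ x in a..b, ψ x) - ∫ x in a..b, ψ (x - s)‖ ≤ 2 * M * |s| := by
  have hi : ∀ c d : ℝ, IntervalIntegrable ψ volume c d := fun c d =>
    ((locallyIntegrable_of_ae_bound hm hM).integrableOn_isCompact
      isCompact_uIcc).intervalIntegrable
  have hb : ∀ c d : ℝ, ‖∫ x in c..d, ψ x‖ ≤ M * |d - c| := fun c d =>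
    intervalIntegral.norm_integral_le_of_norm_le_const_ae
      (hM.mono fun t ht _ => ht)
  rw [intervalIntegral.integral_comp_sub_right,
    intervalIntegral.integral_interval_sub_interval_comm (hi _ _) (hi _ _) (hi _ _)]
  refine (norm_sub_le _ _).trans ((add_le_add (hb _ _) (hb _ _)).trans_eq ?_)
  simp only [sub_sub_cancel_left, abs_neg]
  ring

/-- The averages of `ψ` and of `ψ ∗ f` over long intervals are close if `∫ f = 1`. -/
lemma norm_intervalIntegral_sub_conv_le [CompleteSpace X] {ψ : ℝ → X}
    (hm : AEStronglyMeasurable ψ volume) {M : ℝ} (hM : ∀ᵐ t, ‖ψ t‖ ≤ M) (f : 𝓢(ℝ, ℂ))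
    (hf : ∫ s, f s = 1) :
    ∃ A, 0 ≤ A ∧ ∀ a b : ℝ, a ≤ b →
      ‖(∫ x in a..b, ψ x) - ∫ x in a..b, conv ψ f x‖ ≤ A := by
  have hM0 : 0 ≤ M := by
    obtain ⟨t, ht⟩ := hM.exists
    exact (norm_nonneg _).trans ht
  have hsf : Integrable (fun s : ℝ => |s| * ‖f s‖) volume := by
    simpa using f.integrable_pow_mul volume 1
  refine ⟨2 * M * ∫ s, |s| * ‖f s‖, by positivity, fun a b hab => ?_⟩
  have hac : ((volume : Measure ℝ).restrict (Ioc a b)).prod (volume : Measure ℝ) ≪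
      (volume : Measure ℝ).prod volume :=
    Measure.restrict_le_self.absolutelyContinuous.prod Measure.AbsolutelyContinuous.rfl
  have hmeas : AEStronglyMeasurable (Function.uncurry fun x s : ℝ => f s • ψ (x - s))
      ((volume.restrict (Ioc a b)).prod volume) :=
    (AEStronglyMeasurable.convolution_integrand (ContinuousLinearMap.lsmul ℂ ℂ)
      f.continuous.aestronglyMeasurable hm).mono_ac hac
  -- The bound on `ψ` holds only almost everywhere; it passes to `ψ (x - s)` because subtraction
  -- pulls null sets back to null sets.
  have hae : ∀ᵐ p ∂((volume.restrict (Ioc a b)).prod (volume : Measure ℝ)),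
      ‖ψ (p.1 - p.2)‖ ≤ M :=
    hac.ae_le ((quasiMeasurePreserving_sub volume volume).ae hM)
  have hint : Integrable (Function.uncurry fun x s : ℝ => f s • ψ (x - s))
      ((volume.restrict (Ioc a b)).prod volume) := by
    refine Integrable.mono' ((integrable_const M).mul_prod f.integrable.norm) hmeas ?_
    filter_upwards [hae] with p hp
    simp only [Function.uncurry, norm_smul]
    rw [mul_comm]
    gcongr
  have h1 : ∫ x in a..b, conv ψ f x = ∫ s, f s • ∫ x in a..b, ψ (x - s) := by
    simp_rw [intervalIntegral.integral_of_le hab]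
    calc _ = ∫ x in Ioc a b, ∫ s, f s • ψ (x - s) := rfl
      _ = ∫ s, ∫ x in Ioc a b, f s • ψ (x - s) := integral_integral_swap hint
      _ = _ := by simp_rw [integral_smul]
  have h2 : Integrable (fun s => f s • ∫ x in a..b, ψ (x - s)) volume := by
    refine hint.swap.integral_prod_left.congr (ae_of_all _ fun s => ?_)
    simp only [Function.comp_apply, Prod.swap_prod_mk, Function.uncurry_apply_pair]
    rw [integral_smul, intervalIntegral.integral_of_le hab]
  have h3 : ∫ x in a..b, ψ x = ∫ s, f s • ∫ x in a..b, ψ x := by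
    rw [integral_smul_const, hf, one_smul]
  rw [h1, h3, ← integral_sub (f.integrable.smul_const _) h2, ← integral_const_mul]
  refine norm_integral_le_of_norm_le (hsf.const_mul _) (ae_of_all _ fun s => ?_)
  rw [← smul_sub, norm_smul]
  calc _ ≤ ‖f s‖ * (2 * M * |s|) := by
        gcongr; exact norm_intervalIntegral_sub_translate_le hm hM a b s
    _ = _ := by ring

lemma fourierHat_zero (f : ℝ → ℂ) : fourierHat f 0 = ∫ s, f s := by
  simp [fourierHat]

/-- A bounded function for which `0` is a weakly regular point is ergodic with mean `0`. -/
theorem IsWeighted.isErgodicWithMean_zero [CompleteSpace X] {k : ℕ} {ψ : ℝ → X}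
    (hψ : IsWeighted k ψ) (h0 : ∀ t < 0, ψ t = 0) {M : ℝ} (hM : ∀ᵐ t, ‖ψ t‖ ≤ M)
    (hreg : IsWeakRegularPoint (laplace ψ) 0) : IsErgodicWithMean ψ 0 := by
  obtain ⟨f, hf, hC0⟩ := hψ.exists_conv_mem_C0 h0 hreg
  rw [fourierHat_zero] at hf
  obtain ⟨A, hA0, hA⟩ := norm_intervalIntegral_sub_conv_le hψ.aestronglyMeasurable hM f hf
  obtain ⟨K, hK0, hK⟩ := exists_bound_of_mem_C0 hC0
  rw [IsErgodicWithMean, Metric.tendstoUniformlyOn_iff]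
  intro ε hε
  obtain ⟨R₀, hR₀⟩ := eventually_atTop.1
    ((tendsto_zero_iff_norm_tendsto_zero.1 hC0.2).eventually_lt_const (half_pos hε))
  set R := max R₀ 0
  -- Large values of the convolution are confined to `[0, R]`, so they add at most `K R` to an
  -- integral over any `[t, t + T]`; this gives uniformity in `t`.
  have hgle : ∀ x ∈ Ici (0 : ℝ), ‖conv ψ f x‖ ≤ ε / 2 + (Icc 0 R).indicator (fun _ => K) x := by
    intro x hx
    by_cases hxR : x ≤ R
    · rw [indicator_of_mem (show x ∈ Icc 0 R from ⟨hx, hxR⟩)]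
      linarith [hK x hx]
    · rw [indicator_of_notMem fun h => hxR h.2, add_zero]
      exact (hR₀ x ((le_max_left _ _).trans (not_le.1 hxR).le)).le
  have hind : Integrable ((Icc 0 R).indicator fun _ => K) (volume : Measure ℝ) :=
    (integrable_indicator_iff measurableSet_Icc).2 (integrableOn_const (by simp))
  have hconv : ∀ t ∈ Ici (0 : ℝ), ∀ T : ℝ, 0 ≤ T →
      ‖∫ x in t..t + T, conv ψ f x‖ ≤ ε / 2 * T + K * R := by
    intro t ht T hT
    rw [intervalIntegral.integral_of_le (by linarith)]
    have hc : IntegrableOn (fun _ : ℝ => ε / 2) (Ioc t (t + T)) volume :=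
      integrableOn_const (by simp)
    calc _ ≤ ∫ x in Ioc t (t + T), (ε / 2 + (Icc 0 R).indicator (fun _ => K) x) :=
          norm_integral_le_of_norm_le (hc.add hind.integrableOn)
            ((ae_restrict_iff' measurableSet_Ioc).2 (ae_of_all _ fun x hx =>
              hgle x (le_trans ht hx.1.le)))
      _ = (∫ x in Ioc t (t + T), ε / 2) +
          ∫ x in Ioc t (t + T), (Icc 0 R).indicator (fun _ => K) x :=
            integral_add hc hind.integrableOn
      _ ≤ ε / 2 * T + ∫ x, (Icc 0 R).indicator (fun _ => K) x := by
          refine add_le_add (le_of_eq ?_) (setIntegral_le_integral hind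
            (ae_of_all _ fun x => indicator_nonneg (fun _ _ => hK0) x))
          simp [hT, mul_comm]
      _ = _ := by
          rw [integral_indicator measurableSet_Icc]
          simp [R, mul_comm]
  filter_upwards [eventually_gt_atTop (max 0 ((A + K * R) * (2 / ε)))] with T hT t ht
  have hT0 : 0 < T := (le_max_left _ _).trans_lt hT
  have hT1 : A + K * R < ε / 2 * T := by
    have := (le_max_right _ _).trans_lt hT
    rw [← lt_div_iff₀ (by positivity)] at this
    calc _ < T / (2 / ε) := this
      _ = _ := by field_simp
  rw [dist_zero_left, norm_smul, intervalIntegral.integral_comp_add_left, add_zero,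
    Real.norm_of_nonneg (by positivity), one_div, inv_mul_lt_iff₀ hT0]
  have h1 := norm_le_norm_sub_add (∫ x in t..t + T, ψ x) (∫ x in t..t + T, conv ψ f x)
  linarith [hA t (t + T) (by linarith), hconv t ht T hT0.le]

/-- A function with bounded increments for which `0` is a weakly regular point is bounded. -/
theorem IsWeighted.exists_bound_of_increments [CompleteSpace X] {k : ℕ} {B : ℝ → X}
    (hB : IsWeighted k B) (h0 : ∀ t < 0, B t = 0) {M N : ℝ}
    (hinc : ∀ x s, ‖B x - B (x - s)‖ ≤ M * |s| + N)
    (hreg : IsWeakRegularPoint (laplace B) 0) : ∃ C, ∀ t, ‖B t‖ ≤ C := by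
  obtain ⟨f, hf, hC0⟩ := hB.exists_conv_mem_C0 h0 hreg
  rw [fourierHat_zero] at hf
  obtain ⟨K, hK0, hK⟩ := exists_bound_of_mem_C0 hC0
  have hbi : Integrable (fun s : ℝ => M * (|s| * ‖f s‖) + N * ‖f s‖) volume := by
    refine Integrable.add (Integrable.const_mul ?_ _) (f.integrable.norm.const_mul _)
    simpa using f.integrable_pow_mul volume 1
  -- As `∫ f = 1`, the difference is the mean of the increments `B x - B (x - s)` against `f`,
  -- controlled by the first moment of `f`.
  have key : ∀ x, ‖B x - conv B f x‖ ≤ ∫ s, (M * (|s| * ‖f s‖) + N * ‖f s‖) := by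
    intro x
    have hi : Integrable (fun s => f s • B (x - s)) volume := by
      refine (((f.integrable.norm.mul_const ‖B x‖)).add hbi).mono' ?_ (ae_of_all _ fun s => ?_)
      · exact f.continuous.aestronglyMeasurable.smul
          (hB.aestronglyMeasurable.comp_quasiMeasurePreserving
            (quasiMeasurePreserving_sub_left volume x))
      · rw [norm_smul]
        have h2 : ‖B (x - s)‖ ≤ ‖B x‖ + (M * |s| + N) := by
          have := norm_le_norm_add_norm_sub' (B (x - s)) (B x)
          rw [norm_sub_rev] at this
          linarith [hinc x s]
        calc _ ≤ ‖f s‖ * (‖B x‖ + (M * |s| + N)) := by gcongr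
          _ = _ := by simp only [Pi.add_apply]; ring
    have h1 : B x - conv B f x = ∫ s, f s • (B x - B (x - s)) := by
      simp_rw [smul_sub]
      rw [integral_sub (f.integrable.smul_const _) hi, integral_smul_const, hf, one_smul]
      rfl
    rw [h1]
    refine norm_integral_le_of_norm_le hbi (ae_of_all _ fun s => ?_)
    rw [norm_smul]
    calc _ ≤ ‖f s‖ * (M * |s| + N) := by gcongr; exact hinc x s
      _ = _ := by ring
  refine ⟨(∫ s, (M * (|s| * ‖f s‖) + N * ‖f s‖)) + K, fun t => ?_⟩
  rcases lt_or_ge t 0 with ht | ht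
  · rw [h0 t ht, norm_zero]
    exact add_nonneg ((norm_nonneg _).trans (key 0)) hK0
  · linarith [norm_le_norm_sub_add (B t) (conv B f t), key t, hK t ht]

/-! ### Reduction to the point `0` by modulation -/

lemma norm_modulate (ω : ℝ) (φ : ℝ → X) (t : ℝ) : ‖modulate ω φ t‖ = ‖φ t‖ := by
  rw [modulate, norm_smul, Complex.norm_exp]
  simp

lemma IsWeighted.modulate {k : ℕ} {φ : ℝ → X} (hφ : IsWeighted k φ) (ω : ℝ) :
    IsWeighted k (modulate ω φ) := by
  refine ⟨AEStronglyMeasurable.smul (Continuous.aestronglyMeasurable (by fun_prop))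
    hφ.aestronglyMeasurable, ?_⟩
  simpa only [norm_modulate] using hφ.integrable_weight

lemma modulate_eq_zero {φ : ℝ → X} {t : ℝ} (h : φ t = 0) (ω : ℝ) : modulate ω φ t = 0 := by
  rw [modulate, h, smul_zero]

lemma laplace_modulate (ω : ℝ) (φ : ℝ → X) (z : ℂ) :
    laplace (modulate (-ω) φ) z = laplace φ (z + Complex.I * ω) := by
  simp only [laplace, modulate, smul_smul, ← Complex.exp_add]
  congr 1
  ext t
  congr 2
  push_cast
  ring

/-- Modulation translates the Laplace transform along the imaginary axis, so the density and the
test functions are translated by `ω`. -/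
lemma isWeakRegularPoint_modulate {φ : ℝ → X} {ω : ℝ}
    (h : IsWeakRegularPoint (laplace φ) ω) :
    IsWeakRegularPoint (laplace (modulate (-ω) φ)) 0 := by
  obtain ⟨ε, hε, h, hi, H⟩ := h
  have hpre : ∀ y, y + ω ∈ Ioo (ω - ε) (ω + ε) ↔ y ∈ Ioo (0 - ε) (0 + ε) := fun y => by
    constructor <;> rintro ⟨h1, h2⟩ <;> constructor <;> linarith
  have hind : ∀ g : ℝ → X, (fun y => (Ioo (ω - ε) (ω + ε)).indicator g (y + ω)) =
      (Ioo (0 - ε) (0 + ε)).indicator fun y => g (y + ω) := by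
    intro g
    ext y
    by_cases hy : y ∈ Ioo (0 - ε) (0 + ε)
    · rw [indicator_of_mem hy, indicator_of_mem ((hpre y).2 hy)]
    · rw [indicator_of_notMem hy, indicator_of_notMem fun h => hy ((hpre y).1 h)]
  refine ⟨ε, hε, fun s => h (s + ω), ?_, fun u h1 h2 h3 => ?_⟩
  · rw [← integrable_indicator_iff measurableSet_Ioo, ← hind]
    exact ((integrable_indicator_iff measurableSet_Ioo).2 hi).comp_add_right ω
  · have hu1 : ContDiff ℝ ((⊤ : ℕ∞) : WithTop ℕ∞) fun s => u (s - ω) :=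
      h1.comp (contDiff_id.sub contDiff_const)
    have hu2 : HasCompactSupport fun s => u (s - ω) :=
      h2.comp_homeomorph (Homeomorph.subRight ω)
    have hu3 : tsupport (fun s => u (s - ω)) ⊆ Ioo (ω - ε) (ω + ε) := by
      have := tsupport_comp_eq_preimage u (Homeomorph.subRight ω)
      change tsupport (u ∘ Homeomorph.subRight ω) ⊆ _
      rw [this]
      intro y hy
      exact (hpre (y - ω)).2 (h3 hy) |> fun h => by simpa using h
    have hT := H _ hu1 hu2 hu3
    have e1 : ∫ s in Ioo (0 - ε) (0 + ε), u s • h (s + ω) =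
        ∫ s in Ioo (ω - ε) (ω + ε), u (s - ω) • h s := by
      rw [← integral_indicator measurableSet_Ioo, ← integral_indicator measurableSet_Ioo,
        ← integral_add_right_eq_self
          ((Ioo (ω - ε) (ω + ε)).indicator fun s => u (s - ω) • h s) ω, hind]
      simp only [add_sub_cancel_right]
    rw [e1]
    refine hT.congr fun a => ?_
    rw [← integral_add_right_eq_self _ ω]
    congr 1
    ext s
    rw [laplace_modulate, add_sub_cancel_right]
    congr 2
    push_cast
    ring

/-- Convolutions and translates run over the whole line, so the essential bound on the half-line is
carried over to the extension by `0`. -/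
lemma exists_ae_bound {Y : Type*} [NormedAddCommGroup Y] {φ : ℝ → Y} (hφ : MemLInfty φ)
    (h0 : ∀ t < 0, φ t = 0) :
    ∃ M, 0 ≤ M ∧ ∀ᵐ t, ‖φ t‖ ≤ M := by
  refine ⟨(eLpNorm φ ⊤ (volume.restrict (Ici (0 : ℝ)))).toReal, ENNReal.toReal_nonneg, ?_⟩
  have h1 : ∀ᵐ t ∂(volume.restrict (Ici (0 : ℝ))),
      ‖φ t‖ ≤ (eLpNorm φ ⊤ (volume.restrict (Ici (0 : ℝ)))).toReal := by
    filter_upwards [ae_le_eLpNormEssSup (f := φ) (μ := volume.restrict (Ici (0 : ℝ)))] with t ht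
    rw [← eLpNorm_exponent_top] at ht
    simpa using ENNReal.toReal_mono hφ.2.ne ht
  filter_upwards [(ae_restrict_iff' measurableSet_Ici).1 h1] with t ht
  rcases lt_or_ge t 0 with h | h
  · rw [h0 t h, norm_zero]
    exact ENNReal.toReal_nonneg
  · exact ht h

lemma MemLInfty.modulate {φ : ℝ → X} (hφ : MemLInfty φ) (ω : ℝ) :
    MemLInfty (modulate ω φ) :=
  MemLp.congr_norm hφ (AEStronglyMeasurable.smul (Continuous.aestronglyMeasurable (by fun_prop))
    hφ.1) (ae_of_all _ fun t => (norm_modulate ω φ t).symm)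

/-! ### Primitives of bounded functions -/

section primitive

variable {ψ : ℝ → X} {M : ℝ}

lemma norm_primitive_sub_le (hm : AEStronglyMeasurable ψ volume) (hM : ∀ᵐ t, ‖ψ t‖ ≤ M)
    (x y : ℝ) : ‖primitive ψ x - primitive ψ y‖ ≤ M * |x - y| := by
  have hi : ∀ c d : ℝ, IntervalIntegrable ψ volume c d := fun c d =>
    ((locallyIntegrable_of_ae_bound hm hM).integrableOn_isCompact
      isCompact_uIcc).intervalIntegrable
  rw [primitive, primitive, intervalIntegral.integral_interval_sub_left (hi _ _) (hi _ _)]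
  exact intervalIntegral.norm_integral_le_of_norm_le_const_ae (hM.mono fun t ht _ => ht)

lemma primitive_zero : primitive ψ 0 = 0 := by simp [primitive]

lemma primitive_of_neg (h0 : ∀ t < 0, ψ t = 0) {x : ℝ} (hx : x < 0) : primitive ψ x = 0 := by
  rw [primitive, intervalIntegral.integral_symm, intervalIntegral.integral_of_le hx.le,
    integral_Ioc_eq_integral_Ioo, setIntegral_congr_fun (g := fun _ => 0) measurableSet_Ioo
    fun t ht => h0 t ht.2]
  simp

lemma lipschitzWith_primitive (hm : AEStronglyMeasurable ψ volume) (hM : ∀ᵐ t, ‖ψ t‖ ≤ M) :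
    LipschitzWith M.toNNReal (primitive ψ) := by
  refine LipschitzWith.of_dist_le_mul fun x y => ?_
  rw [dist_eq_norm, Real.dist_eq]
  refine (norm_primitive_sub_le hm hM x y).trans ?_
  gcongr
  exact Real.le_coe_toNNReal M

lemma IsWeighted.integrableOn_exp_smul {k : ℕ} {φ : ℝ → X} (hφ : IsWeighted k φ) {z : ℂ}
    (hz : 0 < z.re) : IntegrableOn (fun t : ℝ => Complex.exp (-z * t) • φ t) (Ioi 0) volume := by
  refine (hφ.integrableOn_exp_norm hz).mono' (AEStronglyMeasurable.smul
    (Continuous.aestronglyMeasurable (by fun_prop)) hφ.aestronglyMeasurable.restrict)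
    (ae_of_all _ fun t => ?_)
  rw [norm_smul, Complex.norm_exp]
  simp

lemma isWeighted_primitive (hm : AEStronglyMeasurable ψ volume) (hM : ∀ᵐ t, ‖ψ t‖ ≤ M) :
    IsWeighted (1 + 2) (primitive ψ) := by
  have hM0 : 0 ≤ M := by
    obtain ⟨t, ht⟩ := hM.exists
    exact (norm_nonneg _).trans ht
  refine isWeighted_of_norm_le (lipschitzWith_primitive hm hM).continuous.aestronglyMeasurable
    (C := M) (ae_of_all _ fun t => ?_)
  have := norm_primitive_sub_le hm hM t 0
  rw [primitive_zero, sub_zero, sub_zero] at this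
  rw [pow_one]
  nlinarith

/-- `e^{-zx} Pψ(x)` is the convolution over `(0, x)` of `e^{-zt} ψ(t)` with `e^{-zt}`, and the
integral of a convolution is the product of the integrals. -/
lemma IsWeighted.laplace_primitive [CompleteSpace X] {k : ℕ} (hψ : IsWeighted k ψ) {z : ℂ}
    (hz : 0 < z.re) : laplace (primitive ψ) z = z⁻¹ • laplace ψ z := by
  have hz' : (-z).re < 0 := by simpa using hz
  have h := integral_posConvolution (μ := volume) (ν := volume) (hψ.integrableOn_exp_smul hz)
    (integrableOn_exp_mul_complex_Ioi hz' 0)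
    ((ContinuousLinearMap.lsmul ℝ ℂ : ℂ →L[ℝ] X →L[ℝ] X).flip)
  simp only [ContinuousLinearMap.flip_apply, ContinuousLinearMap.lsmul_apply] at h
  rw [integral_exp_mul_complex_Ioi hz'] at h
  rw [laplace, laplace]
  have h2 : z⁻¹ = -Complex.exp (-z * (0 : ℝ)) / -z := by simp
  rw [h2, ← h]
  congr 1
  ext x
  rw [primitive, ← intervalIntegral.integral_smul]
  congr 1
  ext t
  rw [smul_smul, ← Complex.exp_add]
  congr 2
  push_cast
  ring

end primitive

/-! ### Holomorphic extension and ergodicity of the primitive -/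

/-- A function whose Laplace transform extends continuously to a neighbourhood of `0` is weakly
regular at `0`. -/
lemma isWeakRegularPoint_of_continuousOn {F D : ℂ → X} {r : ℝ} (hr : 0 < r)
    (hD : ContinuousOn D (Metric.ball 0 r))
    (hF : ∀ z ∈ Metric.ball (0 : ℂ) r, 0 < z.re → F z = D z) : IsWeakRegularPoint F 0 := by
  -- Bounding both coordinates by `r / 3` keeps `a + is` in a compact disc inside the ball, where
  -- `D` is bounded; this bound serves for dominated convergence.
  have hball : ∀ a s : ℝ, |a| ≤ r / 3 → |s| ≤ r / 3 →
      (a + Complex.I * s : ℂ) ∈ Metric.closedBall (0 : ℂ) (2 * r / 3) := by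
    intro a s ha hs
    rw [mem_closedBall_zero_iff]
    refine (norm_add_le _ _).trans ?_
    simp only [norm_mul, Complex.norm_I, one_mul, Complex.norm_real, Real.norm_eq_abs]
    linarith
  have hsub : Metric.closedBall (0 : ℂ) (2 * r / 3) ⊆ Metric.ball 0 r :=
    Metric.closedBall_subset_ball (by linarith)
  have hI : ∀ s ∈ Ioo (0 - r / 3) (0 + r / 3), |s| ≤ r / 3 := fun s hs =>
    abs_le.2 ⟨by linarith [hs.1], by linarith [hs.2]⟩
  obtain ⟨C, hC⟩ := (isCompact_closedBall (0 : ℂ) (2 * r / 3)).exists_bound_of_continuousOn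
    (hD.mono hsub)
  have hcont : ∀ a : ℝ, |a| ≤ r / 3 →
      ContinuousOn (fun s : ℝ => D (a + Complex.I * s)) (Ioo (0 - r / 3) (0 + r / 3)) :=
    fun a ha => hD.comp (Continuous.continuousOn (by fun_prop)) fun s hs =>
      hsub (hball a s ha (hI s hs))
  have h0 : |(0 : ℝ)| ≤ r / 3 := by rw [abs_zero]; positivity
  refine ⟨r / 3, by positivity, fun s => D (((0 : ℝ) : ℂ) + Complex.I * s), ?_,
    fun u h1 h2 h3 => ?_⟩
  · exact (integrableOn_const (C := C) (by simp)).mono'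
      ((hcont 0 h0).aestronglyMeasurable measurableSet_Ioo)
      ((ae_restrict_iff' measurableSet_Ioo).2 (ae_of_all _ fun s hs => hC _ (hball 0 s h0 (hI s hs))))
  have hsmall : ∀ᶠ a : ℝ in 𝓝[>] 0, a ∈ Ioc 0 (r / 3) := Ioc_mem_nhdsGT (by positivity)
  have habs : ∀ a : ℝ, a ∈ Ioc 0 (r / 3) → |a| ≤ r / 3 := fun a ha => by
    rw [abs_of_pos ha.1]; exact ha.2
  refine Tendsto.congr' (f₁ := fun a : ℝ =>
    ∫ s in Ioo (0 - r / 3) (0 + r / 3), u s • D (a + Complex.I * s)) ?_ ?_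
  · filter_upwards [hsmall] with a ha
    refine (setIntegral_congr_fun measurableSet_Ioo fun s hs => ?_).trans
      (setIntegral_eq_integral_of_forall_compl_eq_zero fun s hs => by
        rw [eq_zero_of_notMem_of_tsupport_subset h3 hs, zero_smul])
    rw [hF _ (hsub (hball a s (habs a ha) (hI s hs))) (by simpa using ha.1)]
  refine tendsto_integral_filter_of_dominated_convergence (fun s => ‖u s‖ * C) ?_ ?_
    ((h1.continuous.integrable_of_hasCompactSupport h2).norm.mul_const C).integrableOn ?_
  · filter_upwards [hsmall] with a ha
    exact (h1.continuous.continuousOn.smul (hcont a (habs a ha))).aestronglyMeasurable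
      measurableSet_Ioo
  · filter_upwards [hsmall] with a ha
    refine (ae_restrict_iff' measurableSet_Ioo).2 (ae_of_all _ fun s hs => ?_)
    rw [norm_smul]
    gcongr
    exact hC _ (hball a s (habs a ha) (hI s hs))
  · refine (ae_restrict_iff' measurableSet_Ioo).2 (ae_of_all _ fun s hs => ?_)
    refine Tendsto.const_smul ?_ _
    have hDc : ContinuousAt D (((0 : ℝ) : ℂ) + Complex.I * s) :=
      hD.continuousAt (Metric.isOpen_ball.mem_nhds (hsub (hball 0 s h0 (hI s hs))))
    have hg : Tendsto (fun a : ℝ => (a + Complex.I * s : ℂ)) (𝓝[>] 0)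
        (𝓝 (((0 : ℝ) : ℂ) + Complex.I * s)) :=
      (Continuous.tendsto (by fun_prop) (0 : ℝ)).mono_left nhdsWithin_le_nhds
    exact hDc.tendsto.comp hg

/-- If the Laplace transform of a bounded function extends holomorphically to a neighbourhood of
`0`, then its primitive is bounded and ergodic, with the value of the extension as mean. -/
theorem IsWeighted.primitive_sub_mem [CompleteSpace X] {k : ℕ} {ψ : ℝ → X}
    (hψ : IsWeighted k ψ) (h0 : ∀ t < 0, ψ t = 0) {M : ℝ} (hM : ∀ᵐ t, ‖ψ t‖ ≤ M) {G : ℂ → X}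
    (hG : IsHolomorphicExtensionAt (laplace ψ) 0 G) :
    (fun t => primitive ψ t - G 0) ∈ BUC X ∩ E0 X := by
  have hm := hψ.aestronglyMeasurable
  set c := G 0
  -- The constant is subtracted only on the half-line, so that `B` vanishes for `t < 0`. The price
  -- is a jump of size `‖c‖` at `0`, hence the term `‖c‖` in the increments.
  set B : ℝ → X := fun t => primitive ψ t - (Ici (0 : ℝ)).indicator (fun _ => c) t
  have hBpos : ∀ t ∈ Ici (0 : ℝ), B t = primitive ψ t - c := fun t ht => by
    simp only [B, indicator_of_mem ht]
  have hB0 : ∀ t < 0, B t = 0 := fun t ht => by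
    simp [B, primitive_of_neg h0 ht, ht]
  have hP := isWeighted_primitive hm hM
  have hind : ∀ x s : ℝ, ‖(Ici (0 : ℝ)).indicator (fun _ => c) x -
      (Ici (0 : ℝ)).indicator (fun _ => c) (x - s)‖ ≤ ‖c‖ := by
    intro x s
    by_cases hx : x ∈ Ici (0 : ℝ) <;> by_cases hy : x - s ∈ Ici (0 : ℝ) <;>
      simp only [indicator_of_mem, indicator_of_notMem, hx, hy, not_false_eq_true, sub_self,
        sub_zero, zero_sub, norm_neg, norm_zero, norm_nonneg, le_refl]
  have hinc : ∀ x s, ‖B x - B (x - s)‖ ≤ M * |s| + ‖c‖ := by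
    intro x s
    have h1 := norm_primitive_sub_le hm hM x (x - s)
    rw [sub_sub_cancel] at h1
    simp only [B]
    rw [sub_sub_sub_comm]
    exact (norm_sub_le _ _).trans (add_le_add h1 (hind x s))
  have hBw : IsWeighted (1 + 2) B := by
    have hcw : IsWeighted (0 + 2) fun t : ℝ => (Ici (0 : ℝ)).indicator (fun _ => c) t :=
      isWeighted_of_norm_le (aestronglyMeasurable_const.indicator measurableSet_Ici) (C := ‖c‖)
        (ae_of_all _ fun t => by
          rw [pow_zero, mul_one]; exact norm_indicator_le_norm_self (fun _ => c) t)
    refine isWeighted_of_norm_le (hP.aestronglyMeasurable.sub hcw.aestronglyMeasurable)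
      (C := M + ‖c‖) (ae_of_all _ fun t => ?_)
    have hM0 : 0 ≤ M := by
      obtain ⟨t, ht⟩ := hM.exists
      exact (norm_nonneg _).trans ht
    have h1 := norm_primitive_sub_le hm hM t 0
    rw [primitive_zero, sub_zero, sub_zero] at h1
    have h2 : ‖(Ici (0 : ℝ)).indicator (fun _ => c) t‖ ≤ ‖c‖ :=
      norm_indicator_le_norm_self (fun _ => c) t
    rw [pow_one]
    refine (norm_sub_le _ _).trans ((add_le_add h1 h2).trans ?_)
    nlinarith [abs_nonneg t, norm_nonneg c]
  have hlap : ∀ z : ℂ, 0 < z.re → laplace B z = z⁻¹ • (laplace ψ z - c) := by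
    intro z hz
    have hz' : (-z).re < 0 := by simpa using hz
    have e1 : laplace B z = ∫ t in Ioi (0 : ℝ), (Complex.exp (-z * t) • primitive ψ t -
        Complex.exp (-z * t) • c) :=
      setIntegral_congr_fun measurableSet_Ioi fun t ht => by
        simp only [hBpos t (Ioi_subset_Ici_self ht), smul_sub]
    rw [e1, integral_sub (hP.integrableOn_exp_smul hz)
      ((integrableOn_exp_mul_complex_Ioi hz' 0).smul_const c), integral_smul_const,
      integral_exp_mul_complex_Ioi hz', smul_sub, ← hψ.laplace_primitive hz]
    simp [laplace]
  have hreg : IsWeakRegularPoint (laplace B) 0 := by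
    obtain ⟨V, hVo, hV0, hGd, hGe⟩ := hG
    obtain ⟨r, hr, hrV⟩ := Metric.isOpen_iff.1 hVo 0 hV0
    have hVn : V ∈ 𝓝 (0 : ℂ) := hVo.mem_nhds hV0
    -- The difference quotient of `G` at `0`, completed by the derivative there, continues `(ℒψ(z) -
    -- c) / z` across the origin.
    refine isWeakRegularPoint_of_continuousOn hr (D := dslope G 0)
      (((continuousOn_dslope hVn).2 ⟨hGd.continuousOn, hGd.differentiableAt hVn⟩).mono hrV)
      fun z hz hzre => ?_
    have hz0 : z ≠ 0 := by
      rintro rfl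
      simp at hzre
    rw [hlap z hzre, dslope_of_ne _ hz0, slope_def_module, sub_zero, ← hGe ⟨hrV hz, hzre⟩]
  -- The same weak regularity is used twice: first for boundedness, which the ergodic argument
  -- needs, then for ergodicity.
  obtain ⟨C, hC⟩ := hBw.exists_bound_of_increments hB0 hinc hreg
  have herg := hBw.isErgodicWithMean_zero hB0 (ae_of_all _ hC) hreg
  have hlip := lipschitzWith_primitive hm hM
  have hbd : ∀ t ∈ Ici (0 : ℝ), ‖primitive ψ t - c‖ ≤ C := fun t ht => by
    rw [← hBpos t ht]; exact hC t
  refine ⟨⟨⟨C, hbd⟩, ?_⟩, ?_, ?_⟩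
  · exact (hlip.uniformContinuous.sub uniformContinuous_const).uniformContinuousOn
  · exact memLp_top_of_bound (hlip.continuous.sub continuous_const).aestronglyMeasurable C
      ((ae_restrict_iff' measurableSet_Ici).2 (ae_of_all _ hbd))
  · refine herg.congr ?_
    filter_upwards [eventually_ge_atTop 0] with T hT t ht
    simp only
    congr 1
    refine intervalIntegral.integral_congr fun s hs => ?_
    rw [uIcc_of_le hT] at hs
    exact hBpos _ (add_nonneg ht hs.1)

lemma IsHolomorphicExtensionAt.modulate {φ : ℝ → X} {ω : ℝ} {G : ℂ → X}
    (hG : IsHolomorphicExtensionAt (laplace φ) (Complex.I * ω) G) :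
    IsHolomorphicExtensionAt (laplace (modulate (-ω) φ)) 0 fun z => G (z + Complex.I * ω) := by
  obtain ⟨V, hVo, hV, hGd, hGe⟩ := hG
  refine ⟨(fun z => z + Complex.I * ω) ⁻¹' V, hVo.preimage (by fun_prop), by simpa using hV,
    hGd.comp (by fun_prop) fun z hz => hz, fun z hz => ?_⟩
  rw [laplace_modulate]
  exact hGe ⟨hz.1, by simpa using hz.2⟩

end HalfLine

theorem theorem2p4 {X : Type*} [NormedAddCommGroup X] [NormedSpace ℂ X] [CompleteSpace X]
    (φ : ℝ → X) (hφ : HalfLine.IsTemperedHalfLineFun φ) :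
    (∀ f : 𝓢(ℝ, ℂ), HalfLine.IsTemperedFun (HalfLine.conv φ f) ∧
      HalfLine.weakLaplaceSpectrum (HalfLine.conv φ f) ⊆
        HalfLine.weakLaplaceSpectrum φ ∩ tsupport (HalfLine.fourierHat f)) ∧
    HalfLine.reducedBeurlingSpectrum (HalfLine.C0 X) φ ⊆ HalfLine.weakLaplaceSpectrum φ ∧
    (HalfLine.MemLInfty φ → ∀ ω₀ : ℝ, ω₀ ∉ HalfLine.weakLaplaceSpectrum φ →
      HalfLine.modulate (-ω₀) φ ∈ HalfLine.E0 X) ∧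
    (HalfLine.MemLInfty φ → ∀ ω₀ : ℝ, ω₀ ∉ HalfLine.laplaceSpectrum φ →
      ∀ G : ℂ → X,
        HalfLine.IsHolomorphicExtensionAt (HalfLine.laplace φ) (Complex.I * ω₀) G →
        (fun t => HalfLine.primitive (HalfLine.modulate (-ω₀) φ) t - G (Complex.I * ω₀)) ∈
          HalfLine.BUC X ∩ HalfLine.E0 X) := by
  obtain ⟨⟨hloc, hint, -⟩, h0⟩ := hφ
  obtain ⟨k, hk⟩ := HalfLine.exists_isWeighted hloc hint h0
  have h0' : ∀ ω : ℝ, ∀ t < 0, HalfLine.modulate ω φ t = 0 := fun ω t ht =>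
    HalfLine.modulate_eq_zero (h0 t ht) ω
  refine ⟨fun f => ⟨?_, hk.weakLaplaceSpectrum_conv_subset h0 f⟩, fun ω hω hreg => ?_,
    fun hb ω hω => ?_, fun hb ω _ G hG => ?_⟩
  · exact (hk.isWeighted_conv f).isTemperedFun (hk.continuous_conv f).locallyIntegrable
  · obtain ⟨f, hf, hC0⟩ := hk.exists_conv_mem_C0 h0 hreg
    exact hω ⟨f, by rw [hf]; exact one_ne_zero, hC0⟩
  · obtain ⟨M, -, hM⟩ := HalfLine.exists_ae_bound (hb.modulate (-ω)) (h0' (-ω))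
    exact ⟨hb.modulate (-ω), (hk.modulate (-ω)).isErgodicWithMean_zero (h0' (-ω)) hM
      (HalfLine.isWeakRegularPoint_modulate (not_not.1 hω))⟩
  · obtain ⟨M, -, hM⟩ := HalfLine.exists_ae_bound (hb.modulate (-ω)) (h0' (-ω))
    simpa only [zero_add] using
      (hk.modulate (-ω)).primitive_sub_mem (h0' (-ω)) hM hG.modulate

end
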